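/- Let $G=(V,E)$ be an undirected unweighted graph on $n$ vertices with vertex priorities $\ell:V\to\{0,1,\dots,k\}$. Put $T_i=\{v\in V:\ell(v)\ge i\}$ and let $T=T_1$ be the set of terminals; assume that all terminals lie in one connected component of $G$. A multi-priority $(\alpha,\beta)$-spanner of $(G,\ell)$ is a subgraph $H$ of $G$ together with edge rates $R:E(H)\to\{1,\dots,k\}$ such that, for every $i\in\{1,\dots,k\}$, the graph $H_i$ formed by the edges of $H$ of rate at least $i$ connects all vertices of $T_i$ and satisfies $d_{H_i}(u,v)\le\alpha\,d_G(u,v)+\beta$ for all $u,v\in T_i$. For every $\varepsilon_0>0$ there are a constant $C$ and a polynomial $p$, depending only on $\varepsilon_0$, such that for every real $\varepsilon$ with $0<\varepsilon\le\varepsilon_0$ there is an algorithm which, given any such $G$ and $\ell$ (with $n$ and $k$ arbitrary), computes a multi-priority $(1+\varepsilon,4)$-spanner $(H,R)$ with $$|E(H)|\;\le\; C\,n\sqrt{\frac{|T|\log n}{\varepsilon}}$$ edges, and hence of total weight $\sum_{e\in E(H)}R(e)\le k\,C\,n\sqrt{|T|\log n/\varepsilon}$. The running time is at most $p$ of the length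 of the input (adjacency matrix of $G$ and the priorities in binary), measured as the number of elementary operations of a random access machine with addition and subtraction. -/

import Mathlib

noncomputable section

namespace PrioritySpanner

/-! ### Machine model

Random access machine programs with structured control flow.  The memory consists of arrays of
natural numbers (a program mentions finitely many of them).  The arithmetic operations are addition
and truncated subtraction; there is no multiplication, so numbers gain a bounded number of bits per
step and the model, with unit cost per operation, is polynomially equivalent to Turing machines. -/

/-- The memory: `s a i` is the content of cell `i` of array `a`. -/
abbrev Memory : Type := ℕ → ℕ → ℕ

/-- Expressions: constants, reading a cell (indirect addressing allowed), addition and truncated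
subtraction. -/
inductive Expr : Type
  | const (c : ℕ) : Expr
  | get (a : ℕ) (i : Expr) : Expr
  | add (x y : Expr) : Expr
  | sub (x y : Expr) : Expr

/-- The value of an expression. -/
def Expr.eval (s : Memory) : Expr → ℕ
  | .const c => c
  | .get a i => s a (i.eval s)
  | .add x y => x.eval s + y.eval s
  | .sub x y => x.eval s - y.eval s

/-- The number of elementary operations made in evaluating an expression. -/
def Expr.cost : Expr → ℕ
  | .const _ => 1
  | .get _ i => 1 + i.cost
  | .add x y => 1 + x.cost + y.cost
  | .sub x y => 1 + x.cost + y.cost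

/-- Programs.  A test counts as passed when its value is not zero. -/
inductive Program : Type
  | skip : Program
  | set (a : ℕ) (i e : Expr) : Program
  | seq (c d : Program) : Program
  | ite (b : Expr) (c d : Program) : Program
  | loop (b : Expr) (c : Program) : Program

/-- The memory after writing `x` to cell `i` of array `a`. -/
def Memory.write (s : Memory) (a i x : ℕ) : Memory :=
  fun a' i' => if a' = a ∧ i' = i then x else s a' i'

/-- `Exec c s s' t`: started in memory `s`, the program `c` halts in memory `s'` after exactly
`t` steps. -/
inductive Exec : Program → Memory → Memory → ℕ → Prop
  | skip (s : Memory) : Exec .skip s s 1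
  | set (a : ℕ) (i e : Expr) (s : Memory) :
      Exec (.set a i e) s (s.write a (i.eval s) (e.eval s)) (1 + i.cost + e.cost)
  | seq {c d : Program} {s s' s'' : Memory} {t t' : ℕ} :
      Exec c s s' t → Exec d s' s'' t' → Exec (.seq c d) s s'' (t + t')
  | ite_pass {b : Expr} {c d : Program} {s s' : Memory} {t : ℕ} :
      b.eval s ≠ 0 → Exec c s s' t → Exec (.ite b c d) s s' (1 + b.cost + t)
  | ite_fail {b : Expr} {c d : Program} {s s' : Memory} {t : ℕ} :
      b.eval s = 0 → Exec d s s' t → Exec (.ite b c d) s s' (1 + b.cost + t)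
  | loop_done {b : Expr} {c : Program} {s : Memory} :
      b.eval s = 0 → Exec (.loop b c) s s (1 + b.cost)
  | loop_step {b : Expr} {c : Program} {s s' s'' : Memory} {t t' : ℕ} :
      b.eval s ≠ 0 → Exec c s s' t → Exec (.loop b c) s' s'' t' →
        Exec (.loop b c) s s'' (1 + b.cost + t + t')

/-! ### Multi-priority sparsification -/

/-- `T_i`, the set of vertices of priority at least `i`. -/
def terminals {V : Type*} {k : ℕ} (ℓ : V → Fin (k + 1)) (i : ℕ) : Set V :=
  {v | i ≤ (ℓ v : ℕ)}

/-- `H` is a valid `(α, β)`-spanner of `G` over the terminals `T`: a subgraph of `G` in which the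
terminals lie in one connected component and distances between terminals are at most `α` times
their distance in `G`, plus `β`.  (Subgraphs are taken with vertex set `V`, so that a terminal is
never missing from `H`.) -/
def IsSubsetSpanner {V : Type*} (α β : ℝ) (G : SimpleGraph V) (T : Set V) (H : SimpleGraph V) :
    Prop :=
  H ≤ G ∧
  (∀ u ∈ T, ∀ v ∈ T, H.Reachable u v) ∧
  (∀ u ∈ T, ∀ v ∈ T, (H.dist u v : ℝ) ≤ α * (G.dist u v : ℝ) + β)

/-- A subgraph of `G` whose edges carry rates in `{1, …, k}` (values of `rate` off the edge set are
irrelevant). -/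
structure RatedSubgraph {V : Type*} (G : SimpleGraph V) (k : ℕ) where
  graph : SimpleGraph V
  graph_le : graph ≤ G
  rate : Sym2 V → ℕ
  one_le_rate : ∀ e ∈ graph.edgeSet, 1 ≤ rate e
  rate_le : ∀ e ∈ graph.edgeSet, rate e ≤ k

namespace RatedSubgraph

variable {V : Type*} {G : SimpleGraph V} {k : ℕ}

/-- The subgraph formed by the edges of rate at least `i`. -/
def level (H : RatedSubgraph G k) (i : ℕ) : SimpleGraph V where
  Adj u v := H.graph.Adj u v ∧ i ≤ H.rate s(u, v)
  symm := ⟨fun u v h => ⟨h.1.symm, by rw [Sym2.eq_swap]; exact h.2⟩⟩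
  loopless := ⟨fun u h => H.graph.irrefl h.1⟩

/-- The number of edges. -/
def size (H : RatedSubgraph G k) : ℕ := H.graph.edgeSet.ncard

/-- The total weight of a rated subgraph of a finite unweighted graph: an edge of rate `r` has
weight `r`. -/
def weight (H : RatedSubgraph G k) : ℕ := ∑ᶠ e ∈ H.graph.edgeSet, H.rate e

/-- `H` is a `k`-priority sparsification, where `F T` is the set of valid sparsifications over the
terminal set `T`. -/
def IsPrioritySparsification (H : RatedSubgraph G k) (ℓ : V → Fin (k + 1))
    (F : Set V → Set (SimpleGraph V)) : Prop :=
  ∀ i : ℕ, 1 ≤ i → i ≤ k → H.level i ∈ F (terminals ℓ i)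

/-- `H` is a multi-priority `(α, β)`-spanner of `G` for the vertex priorities `ℓ`. -/
def IsPrioritySpanner (H : RatedSubgraph G k) (ℓ : V → Fin (k + 1)) (α β : ℝ) : Prop :=
  H.IsPrioritySparsification ℓ fun T => {K | IsSubsetSpanner α β G T K}

end RatedSubgraph

/-! ### Input and output of the algorithms -/

open scoped Classical in
/-- The initial memory for a graph on `n` vertices with priorities in `{0, …, k}`: array `0`
holds `n` and `k`, array `1` the adjacency matrix row by row, array `2` the vertex priorities; all
other cells are `0`. -/
def inputMemory {n k : ℕ} (G : SimpleGraph (Fin n)) (ℓ : Fin n → Fin (k + 1)) : Memory :=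
  fun a i =>
    if a = 0 then (if i = 0 then n else if i = 1 then k else 0)
    else if a = 1 then
      (if ∃ u v : Fin n, i = (u : ℕ) * n + (v : ℕ) ∧ G.Adj u v then 1 else 0)
    else if a = 2 then (if h : i < n then ((ℓ ⟨i, h⟩ : Fin (k + 1)) : ℕ) else 0)
    else 0

/-- The length in bits of the input: the adjacency matrix, the numbers `n` and `k`, and `n`
priorities of the length of `k`. -/
def inputSize (n k : ℕ) : ℕ := n ^ 2 + n.size + (n + 1) * k.size

open scoped Classical in
/-- The memory `s` holds `H` as output: array `3` holds, row by row, the matrix whose entry at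
`(u, v)` is the rate of the edge `uv` if `uv` is an edge of `H`, and `0` otherwise. -/
def IsOutput {n k : ℕ} {G : SimpleGraph (Fin n)} (s : Memory) (H : RatedSubgraph G k) : Prop :=
  ∀ u v : Fin n,
    s 3 ((u : ℕ) * n + (v : ℕ)) = if H.graph.Adj u v then H.rate s(u, v) else 0

end PrioritySpanner

end

namespace PrioritySpanner

/-! ### Programs built from bounded loops -/

/-! One graph serves all levels. If `H` preserves distances between vertices of `T` up to an
additive 2, then `H` with every edge at rate `k` is valid for each `T_i ⊆ T`, and 2 is within the
allowed error. A purely additive subset spanner with at most `12 * n * √|T|` edges therefore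
suffices. The factor `√(log n / ε)` is slack: for `n ≥ 2` it is at least `√(log 2 / ε₀)`, and for `n
< 2` there are no edges. Neither the program nor its time bound depends on `ε`.

The additive spanner comes from clustering and path buying, with `d = ⌈√|T|⌉`. Scan the vertices;
whenever one has at least `d` unclustered neighbours, join it to all of them by a star, of which it
is the center. The stars cost at most `n` edges, and there are at most `n / d` centers. At the end
each vertex has at most `d` unclustered neighbours, so all edges with an unclustered endpoint can be
bought for `n * d`. Now every missing edge has clustered endpoints. For each pair of terminals whose
distance is still off by more than 2, buy a geodesic of `G`.

The purchases are paid for by triples (terminal, center, error in `{0, 1, 2}`) recording how well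
`H` approximates a distance. A geodesic meets a cluster in at most three missing edges, counted by
first endpoint, and each cluster met yields a new triple with one end of the path: otherwise the old
distances through its center would already join the ends with error 2. Hence purchases total at most
`9 * |T| * (n / d)`. The charging is `card_edgeSet_add_card_good_le`, the arithmetic
`cast_le_of_clusters`.

The algorithm is written in a language of loops bounded by `n`, where termination is automatic and
`exec_compile` yields real executions with a polynomial step bound. Correctness of each loop is an
invariant fed to `run_iter`; `spanner_spec` assembles the pieces. -/

/-- Programs whose only loops run a counter through `0, …, n - 1`, where `n` is the content of cell
`0` of array `0`; the counter of `iter v c` is cell `0` of array `v`. -/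
inductive Cmd : Type
  | skip : Cmd
  | set (a : ℕ) (i e : Expr) : Cmd
  | seq (c d : Cmd) : Cmd
  | ite (b : Expr) (c d : Cmd) : Cmd
  | iter (v : ℕ) (c : Cmd) : Cmd

namespace Cmd

/-- The arrays that a program writes to. -/
def writes : Cmd → List ℕ
  | skip => []
  | set a _ _ => [a]
  | seq c d => c.writes ++ d.writes
  | ite _ c d => c.writes ++ d.writes
  | iter v c => v :: c.writes

/-- No loop body writes to the counter or to the bound of its loop. -/
def Valid : Cmd → Prop
  | skip => True
  | set _ _ _ => True
  | seq c d => c.Valid ∧ d.Valid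
  | ite _ c d => c.Valid ∧ d.Valid
  | iter v c => c.Valid ∧ v ∉ c.writes ∧ 0 ∉ c.writes ∧ v ≠ 0

instance decidableValid : (c : Cmd) → Decidable c.Valid
  | skip => instDecidableTrue
  | set _ _ _ => instDecidableTrue
  | seq c d => @instDecidableAnd _ _ c.decidableValid d.decidableValid
  | ite _ c d => @instDecidableAnd _ _ c.decidableValid d.decidableValid
  | iter v c => @instDecidableAnd _ _ c.decidableValid
      (inferInstanceAs (Decidable (v ∉ c.writes ∧ 0 ∉ c.writes ∧ v ≠ 0)))

/-- The translation to random access machine programs. -/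
def compile : Cmd → Program
  | skip => .skip
  | set a i e => .set a i e
  | seq c d => .seq c.compile d.compile
  | ite b c d => .ite b c.compile d.compile
  | iter v c => .seq (.set v (.const 0) (.const 0))
      (.loop (.sub (.get 0 (.const 0)) (.get v (.const 0)))
        (.seq c.compile (.set v (.const 0) (.add (.get v (.const 0)) (.const 1)))))

/-- The final memory. -/
def run : Cmd → Memory → Memory
  | skip, s => s
  | set a i e, s => s.write a (i.eval s) (e.eval s)
  | seq c d, s => d.run (c.run s)
  | ite b c d, s => if b.eval s ≠ 0 then c.run s else d.run s
  | iter v c, s =>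
      (fun s' => (c.run s').write v 0 (c.run s' v 0 + 1))^[s 0 0] (s.write v 0 0)

/-- A bound for the running time, as a polynomial in the bound of the loops. -/
noncomputable def time : Cmd → Polynomial ℕ
  | skip => 1
  | set _ i e => Polynomial.C (1 + i.cost + e.cost)
  | seq c d => c.time + d.time
  | ite b c d => Polynomial.C (1 + b.cost) + c.time + d.time
  | iter _ c => 9 + Polynomial.X * (c.time + 12)

end Cmd

/-! ### Semantics of bounded loops and their execution -/

theorem Memory.write_same (s : Memory) (a i x : ℕ) :
    s.write a i x a = Function.update (s a) i x := by
  funext j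
  simp [Memory.write, Function.update_apply]

theorem Memory.write_of_ne (s : Memory) {a b : ℕ} (i x : ℕ) (h : b ≠ a) :
    s.write a i x b = s b := by
  funext j
  simp [Memory.write, h]

namespace Cmd

/-- The frame rule: for a concrete program it reduces preservation of an array to a decidable
membership check. -/
theorem run_of_notMem_writes (c : Cmd) {a : ℕ} (h : a ∉ c.writes) (s : Memory) :
    c.run s a = s a := by
  induction c generalizing s with
  | skip => rfl
  | set b i e =>
    simp only [writes, List.mem_singleton] at h
    exact Memory.write_of_ne _ _ _ h
  | seq c d hc hd =>
    simp only [writes, List.mem_append, not_or] at h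
    simp only [run, hd h.2, hc h.1]
  | ite b c d hc hd =>
    simp only [writes, List.mem_append, not_or] at h
    simp only [run]
    split_ifs
    · exact hc h.1 s
    · exact hd h.2 s
  | iter v c hc =>
    simp only [writes, List.mem_cons, not_or] at h
    simp only [run]
    have key : ∀ (m : ℕ) (s' : Memory),
        (fun s' => (c.run s').write v 0 (c.run s' v 0 + 1))^[m] s' a = s' a := by
      intro m
      induction m with
      | zero => intro s'; rfl
      | succ m ih =>
        intro s'
        rw [Function.iterate_succ_apply, ih, Memory.write_of_ne _ _ _ h.1, hc h.2]
    rw [key, Memory.write_of_ne _ _ _ h.1]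

theorem run_ite_pos {b : Expr} {c d : Cmd} {s : Memory} (h : b.eval s ≠ 0) :
    (ite b c d).run s = c.run s := if_pos h

theorem run_ite_neg {b : Expr} {c d : Cmd} {s : Memory} (h : b.eval s = 0) :
    (ite b c d).run s = d.run s := if_neg (not_not.mpr h)

/-- The invariant rule for bounded loops. -/
theorem run_iter {v : ℕ} {c : Cmd} (hv : (iter v c).Valid) (s : Memory)
    (I : ℕ → Memory → Prop) (h0 : I 0 (s.write v 0 0))
    (hstep : ∀ j < s 0 0, ∀ s' : Memory, s' v 0 = j →
      (∀ a, a ∉ (iter v c).writes → s' a = s a) → I j s' →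
      I (j + 1) ((c.run s').write v 0 (j + 1))) :
    I (s 0 0) ((iter v c).run s) := by
  obtain ⟨-, hvc, h0c, hv0⟩ := hv
  -- Invariant, counter value and frame are proved together, since each application of `hstep`
  -- consumes all three.
  have key : ∀ m ≤ s 0 0, ∀ s',
      s' = (fun s' => (c.run s').write v 0 (c.run s' v 0 + 1))^[m] (s.write v 0 0) →
      I m s' ∧ s' v 0 = m ∧ ∀ a, a ∉ (iter v c).writes → s' a = s a := by
    intro m
    induction m with
    | zero =>
      rintro - s' rfl
      refine ⟨h0, by simp [Memory.write], fun a ha => ?_⟩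
      simp only [writes, List.mem_cons, not_or] at ha
      exact Memory.write_of_ne _ _ _ ha.1
    | succ m ih =>
      rintro hm s' rfl
      obtain ⟨h1, h2, h3⟩ := ih (by omega) _ rfl
      rw [Function.iterate_succ_apply']
      set r := (fun s' => (c.run s').write v 0 (c.run s' v 0 + 1))^[m] (s.write v 0 0)
      have hr : c.run r v 0 = m := by rw [run_of_notMem_writes c hvc, h2]
      simp only [hr]
      refine ⟨hstep m (by omega) r h2 h3 h1, by simp [Memory.write], fun a ha => ?_⟩
      have ha' := ha
      simp only [writes, List.mem_cons, not_or] at ha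
      rw [Memory.write_of_ne _ _ _ ha.1, run_of_notMem_writes c ha.2, h3 a ha']
  exact (key _ le_rfl _ rfl).1

/-- Since the loop bound is never written, every subprogram sees the same value of it, so one
polynomial in that value bounds all running times. -/
theorem exec_compile (c : Cmd) (hc : c.Valid) (h0 : 0 ∉ c.writes) (s : Memory) :
    ∃ t, Exec c.compile s (c.run s) t ∧ t ≤ c.time.eval (s 0 0) := by
  induction c generalizing s with
  | skip => exact ⟨1, .skip s, by simp [time]⟩
  | set a i e => exact ⟨_, .set a i e s, by simp [time]⟩
  | seq c d ihc ihd =>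
    simp only [writes, List.mem_append, not_or] at h0
    obtain ⟨t, ht, ht'⟩ := ihc hc.1 h0.1 s
    obtain ⟨r, hr, hr'⟩ := ihd hc.2 h0.2 (c.run s)
    rw [run_of_notMem_writes c h0.1] at hr'
    exact ⟨_, .seq ht hr, by simp only [time, Polynomial.eval_add]; omega⟩
  | ite b c d ihc ihd =>
    simp only [writes, List.mem_append, not_or] at h0
    obtain ⟨t, ht, ht'⟩ := ihc hc.1 h0.1 s
    obtain ⟨r, hr, hr'⟩ := ihd hc.2 h0.2 s
    simp only [run, compile, time, Polynomial.eval_add, Polynomial.eval_C]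
    split_ifs with h
    · exact ⟨_, .ite_pass h ht, by omega⟩
    · exact ⟨_, .ite_fail (not_not.mp h) hr, by omega⟩
  | iter v c ih =>
    obtain ⟨hc, hvc, h0c, hv0⟩ := hc
    -- The loop test costs 6 and the counter increment 6, whence 12 per round and 6 for the final
    -- failed test; initializing the counter adds 3 to give the 9 in `time`.
    have key : ∀ (m : ℕ) (r : Memory), r v 0 + m = r 0 0 →
        ∃ t, Exec (.loop (.sub (.get 0 (.const 0)) (.get v (.const 0)))
            (.seq c.compile (.set v (.const 0) (.add (.get v (.const 0)) (.const 1))))) r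
            ((fun s' => (c.run s').write v 0 (c.run s' v 0 + 1))^[m] r) t ∧
          t ≤ 6 + m * (c.time.eval (r 0 0) + 12) := by
      intro m
      induction m with
      | zero =>
        intro r hr
        refine ⟨_, .loop_done ?_, ?_⟩
        · simp only [Expr.eval]; omega
        · simp [Expr.cost]
      | succ m ihm =>
        intro r hr
        obtain ⟨t, ht, ht'⟩ := ih hc h0c r
        have hv : c.run r v 0 = r v 0 := by rw [run_of_notMem_writes c hvc]
        have hz : (c.run r).write v 0 (c.run r v 0 + 1) 0 0 = r 0 0 := by
          rw [Memory.write_of_ne _ _ _ (Ne.symm hv0), run_of_notMem_writes c h0c]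
        obtain ⟨t', hx, hx'⟩ := ihm ((c.run r).write v 0 (c.run r v 0 + 1)) (by
          rw [hz, Memory.write_same, Function.update_self, hv]; omega)
        rw [Function.iterate_succ_apply]
        refine ⟨_, .loop_step ?_ (.seq ht (.set _ _ _ _)) hx, ?_⟩
        · simp only [Expr.eval]; omega
        · rw [hz] at hx'
          simp only [Expr.cost]
          rw [Nat.succ_mul]
          omega
    have hz : s.write v 0 0 0 = s 0 := Memory.write_of_ne _ _ _ (Ne.symm hv0)
    obtain ⟨t, ht, ht'⟩ := key (s 0 0) (s.write v 0 0) (by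
      rw [hz, Memory.write_same, Function.update_self, zero_add])
    refine ⟨_, .seq (.set _ _ _ _) ht, ?_⟩
    rw [hz] at ht'
    simp only [time, Expr.cost, Polynomial.eval_add, Polynomial.eval_mul, Polynomial.eval_X,
      Polynomial.eval_ofNat]
    omega

end Cmd

/-- Evaluation of a polynomial with natural coefficients is monotone. -/
theorem eval_le_eval_of_le (p : Polynomial ℕ) {x y : ℕ} (h : x ≤ y) : p.eval x ≤ p.eval y := by
  rw [Polynomial.eval_eq_sum, Polynomial.eval_eq_sum]
  exact Finset.sum_le_sum fun i _ => Nat.mul_le_mul_left _ (Nat.pow_le_pow_left h i)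

end PrioritySpanner

namespace PrioritySpanner

/-! ### Subset spanners by clustering and path buying -/

variable {V : Type*}

/-- There is a walk of length at most `m` from `u` to `v`. -/
def Near (H : SimpleGraph V) (u v : V) (m : ℕ) : Prop :=
  ∃ w : H.Walk u v, w.length ≤ m

namespace Near

variable {G H : SimpleGraph V} {u v w : V} {a b : ℕ}

theorem refl (u : V) : Near H u u a := ⟨.nil, Nat.zero_le _⟩

theorem of_adj (h : H.Adj u v) : Near H u v 1 := ⟨.cons h .nil, le_rfl⟩

theorem symm (h : Near H u v a) : Near H v u a :=
  h.imp' (fun p => p.reverse) fun p hp => by rwa [SimpleGraph.Walk.length_reverse]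

theorem trans (h : Near H u v a) (h' : Near H v w b) : Near H u w (a + b) := by
  obtain ⟨p, hp⟩ := h
  obtain ⟨q, hq⟩ := h'
  exact ⟨p.append q, by rw [SimpleGraph.Walk.length_append]; omega⟩

theorem mono (h : Near H u v a) (hab : a ≤ b) : Near H u v b :=
  h.imp fun _ hp => hp.trans hab

theorem mono_graph (h : Near H u v a) (hHG : H ≤ G) : Near G u v a :=
  h.imp' (fun p => p.mapLe hHG) fun p hp => by simpa using hp

theorem reachable (h : Near H u v a) : H.Reachable u v := h.elim fun p _ => p.reachable

theorem dist_le (h : Near H u v a) : H.dist u v ≤ a :=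
  h.elim fun p hp => (SimpleGraph.dist_le p).trans hp

theorem of_dist (h : H.Reachable u v) (ha : H.dist u v ≤ a) : Near H u v a := by
  obtain ⟨p, hp⟩ := h.exists_walk_length_eq_dist
  exact ⟨p, hp.le.trans ha⟩

/-- Splitting off the last edge drives both the induction in the distance computation and the
descent along a geodesic. -/
theorem exists_adj (h : Near H u v (a + 1)) : u = v ∨ ∃ x, Near H u x a ∧ H.Adj x v := by
  obtain ⟨p, hp⟩ := h.symm
  cases p with
  | nil => exact .inl rfl
  | cons hadj q =>
    refine .inr ⟨_, Near.symm ⟨q, ?_⟩, hadj.symm⟩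
    simpa using hp

end Near

/-- The graph formed by the edges of a walk. -/
def walkGraph {G : SimpleGraph V} {u v : V} (p : G.Walk u v) : SimpleGraph V :=
  SimpleGraph.fromEdgeSet {e | e ∈ p.edges}

theorem walkGraph_adj {G : SimpleGraph V} {u v : V} (p : G.Walk u v) {x y : V} :
    (walkGraph p).Adj x y ↔ s(x, y) ∈ p.edges := by
  simp only [walkGraph, SimpleGraph.fromEdgeSet_adj, Set.mem_ofPred_eq, and_iff_left_iff_imp]
  exact fun h => (p.adj_of_mem_edges h).ne

theorem walkGraph_le {G : SimpleGraph V} {u v : V} (p : G.Walk u v) : walkGraph p ≤ G :=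
  fun _ _ h => p.adj_of_mem_edges ((walkGraph_adj p).mp h)

theorem near_walkGraph_take {G H : SimpleGraph V} {u v : V} (p : G.Walk u v)
    (hp : walkGraph p ≤ H) (i : ℕ) : Near H u (p.getVert i) i := by
  have h : ∀ e ∈ (p.take i).edges, e ∈ H.edgeSet := by
    intro e he
    induction e with
    | _ x y =>
      exact hp ((walkGraph_adj p).mpr (p.isSubwalk_take i |>.edges_subset he))
  exact ⟨(p.take i).transfer H h, by
    rw [SimpleGraph.Walk.length_transfer, SimpleGraph.Walk.take_length]; exact min_le_left _ _⟩

theorem near_walkGraph_drop {G H : SimpleGraph V} {u v : V} (p : G.Walk u v)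
    (hp : walkGraph p ≤ H) (i : ℕ) : Near H (p.getVert i) v (p.length - i) := by
  have h : ∀ e ∈ (p.drop i).edges, e ∈ H.edgeSet := by
    intro e he
    induction e with
    | _ x y =>
      exact hp ((walkGraph_adj p).mpr (p.isSubwalk_drop i |>.edges_subset he))
  exact ⟨(p.drop i).transfer H h, by
    rw [SimpleGraph.Walk.length_transfer, SimpleGraph.Walk.drop_length]⟩

/-- Adding an edge. -/
theorem ncard_edgeSet_sup_edge_le [Finite V] (H : SimpleGraph V) (u v : V) :
    (H ⊔ SimpleGraph.edge u v).edgeSet.ncard ≤ H.edgeSet.ncard + 1 := by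
  have h : (H ⊔ SimpleGraph.edge u v).edgeSet ⊆ insert s(u, v) H.edgeSet := by
    intro e he
    induction e with
    | _ x y =>
      simp only [SimpleGraph.mem_edgeSet, SimpleGraph.sup_adj, SimpleGraph.edge_adj] at he
      simp only [Set.mem_insert_iff, SimpleGraph.mem_edgeSet, Sym2.eq_iff]
      tauto
  exact (Set.ncard_le_ncard h (Set.toFinite _)).trans (Set.ncard_insert_le _ _)

/-! ### Charging bought edges to improved distances -/

section PathBuying

open scoped Classical in
/-- The indices of the edges of `p` that `H` lacks. -/
noncomputable def missing (H : SimpleGraph V) {G : SimpleGraph V} {u v : V} (p : G.Walk u v) :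
    Finset ℕ :=
  (Finset.range p.length).filter fun i => ¬ H.Adj (p.getVert i) (p.getVert (i + 1))

/-- Missing edges are counted by their position on the walk, so that each has a distinguished first
endpoint whose cluster can be charged. -/
theorem ncard_edgeSet_sup_walkGraph_le [Finite V] (H : SimpleGraph V) {G : SimpleGraph V}
    {u v : V} (p : G.Walk u v) :
    (H ⊔ walkGraph p).edgeSet.ncard ≤ H.edgeSet.ncard + (missing H p).card := by
  classical
  have h : (H ⊔ walkGraph p).edgeSet ⊆ H.edgeSet ∪
      ((missing H p).image fun i => s(p.getVert i, p.getVert (i + 1)) : Finset (Sym2 V)) := by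
    intro e he
    by_cases heH : e ∈ H.edgeSet
    · exact .inl heH
    refine .inr ?_
    rw [SimpleGraph.edgeSet_sup] at he
    have he' : e ∈ p.edges := by
      induction e with
      | _ x y => exact (walkGraph_adj p).mp (he.resolve_left heH)
    obtain ⟨i, hi, rfl⟩ := List.getElem_of_mem he'
    rw [SimpleGraph.Walk.getElem_edges] at heH ⊢
    rw [SimpleGraph.Walk.length_edges] at hi
    refine Finset.mem_coe.mpr (Finset.mem_image_of_mem _ ?_)
    exact Finset.mem_filter.mpr ⟨Finset.mem_range.mpr hi, heH⟩
  refine (Set.ncard_le_ncard h (Set.toFinite _)).trans ((Set.ncard_union_le _ _).trans ?_)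
  rw [Set.ncard_coe_finset]
  exact Nat.add_le_add_left Finset.card_image_le _

open scoped Classical in
/-- The triples `(t, c, j)` such that `H` approximates the distance from `t` to `c` up to `j`. -/
noncomputable def good (G : SimpleGraph V) (T D : Finset V) (H : SimpleGraph V) :
    Finset (V × V × ℕ) :=
  (T ×ˢ D ×ˢ Finset.range 3).filter fun x => Near H x.1 x.2.1 (G.dist x.1 x.2.1 + x.2.2)

/-- This caps the potential, and hence all purchases together. -/
theorem card_good_le (G : SimpleGraph V) (T D : Finset V) (H : SimpleGraph V) :
    (good G T D H).card ≤ T.card * (D.card * 3) := by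
  classical
  exact (Finset.card_filter_le _ _).trans (by simp [Finset.card_product])

theorem good_mono (G : SimpleGraph V) (T D : Finset V) {H H' : SimpleGraph V} (h : H ≤ H') :
    good G T D H ⊆ good G T D H' := by
  classical
  exact Finset.monotone_filter_right _ fun x _ hx => hx.mono_graph h

/-- Buying a shortest path between two terminals whose distance in `H` is off by more than two pays
for its new edges with new good triples. -/
theorem card_edgeSet_add_card_good_le [Finite V] {G H : SimpleGraph V} {T D : Finset V}
    (hHG : H ≤ G) {ctr : V → V}
    (hctr : ∀ x y, G.Adj x y → ¬ H.Adj x y → ctr x ∈ D ∧ H.Adj (ctr x) x)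
    {u v : V} (hu : u ∈ T) (hv : v ∈ T) (p : G.Walk u v) (hp : p.length = G.dist u v)
    (hfar : ¬ Near H u v (G.dist u v + 2)) :
    (H ⊔ walkGraph p).edgeSet.ncard + 3 * (good G T D H).card ≤
      H.edgeSet.ncard + 3 * (good G T D (H ⊔ walkGraph p)).card := by
  classical
  set H' := H ⊔ walkGraph p with hH'
  have hle : H ≤ H' := le_sup_left
  have hadj : ∀ i ∈ missing H p, ctr (p.getVert i) ∈ D ∧ H.Adj (ctr (p.getVert i)) (p.getVert i) := by
    intro i hi
    simp only [missing, Finset.mem_filter, Finset.mem_range] at hi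
    exact hctr _ _ (p.adj_getVert_succ hi.1) hi.2
  -- every cluster meets the path in at most three missing edges
  have hclose : ∀ i ∈ missing H p, ∀ j ∈ missing H p,
      ctr (p.getVert i) = ctr (p.getVert j) → j ≤ i + 2 := by
    intro i hi j hj hij
    have h1 : Near G (p.getVert i) (p.getVert j) (1 + 1) :=
      ((Near.of_adj (hadj i hi).2).symm.trans
        (hij ▸ Near.of_adj (hadj j hj).2)).mono_graph hHG
    -- A detour through the common center replaces the stretch from `i` to `j` by two edges; a
    -- geodesic cannot be shortened.
    have h2 := (((near_walkGraph_take p (walkGraph_le p) i).trans h1).trans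
      (near_walkGraph_drop p (walkGraph_le p) j)).dist_le
    simp only [missing, Finset.mem_filter, Finset.mem_range] at hj
    omega
  have hM : (missing H p).card ≤ 3 * ((missing H p).image fun i => ctr (p.getVert i)).card := by
    refine Finset.card_le_mul_card_image _ 3 fun c hc => ?_
    obtain ⟨i₀, hi₀, hi₀c⟩ := Finset.mem_image.mp hc
    set F := (missing H p).filter fun i => ctr (p.getVert i) = c
    have hF : F.Nonempty := ⟨i₀, Finset.mem_filter.mpr ⟨hi₀, hi₀c⟩⟩
    have hsub : F ⊆ Finset.Icc (F.min' hF) (F.min' hF + 2) := by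
      intro j hj
      have hm := Finset.mem_filter.mp (F.min'_mem hF)
      have hj' := Finset.mem_filter.mp hj
      exact Finset.mem_Icc.mpr ⟨F.min'_le j hj, hclose _ hm.1 _ hj'.1 (hm.2.trans hj'.2.symm)⟩
    exact (Finset.card_le_card hsub).trans (by simp; omega)
  have hnew : ((missing H p).image fun i => ctr (p.getVert i)) ⊆
      (good G T D H' \ good G T D H).image fun x => x.2.1 := by
    intro c hc
    obtain ⟨i, hi, rfl⟩ := Finset.mem_image.mp hc
    obtain ⟨hD, hs⟩ := hadj i hi
    have hi' : i < p.length := by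
      simp only [missing, Finset.mem_filter, Finset.mem_range] at hi
      exact hi.1
    have hs1 := Near.of_adj hs
    -- Here `a` is the exact distance in `G` from `t` to the path vertex, which the new path
    -- realizes. The center is one edge away, so `a + 1` exceeds its distance from `t` by at most 2,
    -- and this excess is the third entry of the new triple.
    have improve : ∀ t ∈ T, ∀ a, Near H' t (p.getVert i) a →
        (∀ b, Near G t (p.getVert i) b → a ≤ b) → ¬ Near H t (ctr (p.getVert i)) (a + 1) →
        ctr (p.getVert i) ∈ (good G T D H' \ good G T D H).image fun x => x.2.1 := by
      intro t ht a ha hmin hno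
      have h1 : Near H' t (ctr (p.getVert i)) (a + 1) := ha.trans (hs1.symm.mono_graph hle)
      have h2 : G.dist t (ctr (p.getVert i)) ≤ a + 1 :=
        (h1.mono_graph (sup_le hHG (walkGraph_le p))).dist_le
      have h3 : a ≤ G.dist t (ctr (p.getVert i)) + 1 := by
        refine hmin _ (Near.trans (Near.of_dist ?_ le_rfl) (hs1.mono_graph hHG))
        exact (h1.mono_graph (sup_le hHG (walkGraph_le p))).reachable
      refine Finset.mem_image.mpr
        ⟨(t, ctr (p.getVert i), a + 1 - G.dist t (ctr (p.getVert i))), ?_, rfl⟩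
      simp only [good, Finset.mem_sdiff, Finset.mem_filter, Finset.mem_product, Finset.mem_range,
        Nat.add_sub_cancel' h2]
      exact ⟨⟨⟨ht, hD, by omega⟩, h1⟩, fun h => hno h.2⟩
    -- If both ends were already this close to the center, then `(i + 1) + (p.length - i + 1)` would
    -- contradict `hfar`; so one of them improves.
    by_cases hcase : Near H u (ctr (p.getVert i)) (i + 1)
    · refine improve v hv (p.length - i) (near_walkGraph_drop p le_sup_right i).symm ?_ ?_
      · intro b hb
        have := ((near_walkGraph_take p (walkGraph_le p) i).trans hb.symm).dist_le
        omega
      · intro h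
        exact hfar ((hcase.trans h.symm).mono (by omega))
    · refine improve u hu i (near_walkGraph_take p le_sup_right i) ?_ hcase
      intro b hb
      have := (hb.trans (near_walkGraph_drop p (walkGraph_le p) i)).dist_le
      omega
  have h1 := ncard_edgeSet_sup_walkGraph_le H p
  rw [← hH'] at h1
  have h2 := (Finset.card_le_card hnew).trans Finset.card_image_le
  have h3 := Finset.card_sdiff_add_card_eq_card (good_mono G T D hle)
  omega

end PathBuying

/-! ### Edge counts and numerical estimates -/

open scoped Classical in
/-- If every vertex has at most `d` unclustered neighbours, then few edges have an unclustered
endpoint. -/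
theorem ncard_edgeSet_le_of_unclustered [Fintype V] {G H K : SimpleGraph V} {P : V → Prop} {d : ℕ}
    (hd : ∀ x, (Finset.univ.filter fun y => G.Adj x y ∧ ¬ P y).card ≤ d)
    (hK : ∀ x y, K.Adj x y → H.Adj x y ∨ G.Adj x y ∧ (¬ P x ∨ ¬ P y)) :
    K.edgeSet.ncard ≤ H.edgeSet.ncard + Fintype.card V * d := by
  set F : Finset (Sym2 V) := Finset.univ.biUnion fun x =>
    (Finset.univ.filter fun y => G.Adj x y ∧ ¬ P y).image fun y => s(x, y) with hF
  have hFc : F.card ≤ Fintype.card V * d :=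
    Finset.card_biUnion_le_card_mul _ _ _ fun x _ => Finset.card_image_le.trans (hd x)
  have h : K.edgeSet ⊆ H.edgeSet ∪ (F : Set (Sym2 V)) := by
    intro e he
    induction e with
    | _ x y =>
      simp only [hF, Set.mem_union, SimpleGraph.mem_edgeSet, Finset.mem_coe, Finset.mem_biUnion,
        Finset.mem_image, Finset.mem_filter, Finset.mem_univ, true_and]
      rcases hK x y he with h | ⟨h, hx | hy⟩
      · exact .inl h
      · exact .inr ⟨y, x, ⟨h.symm, hx⟩, Sym2.eq_swap⟩
      · exact .inr ⟨x, y, ⟨h, hy⟩, rfl⟩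
  refine (Set.ncard_le_ncard h (Set.toFinite _)).trans ((Set.ncard_union_le _ _).trans ?_)
  rw [Set.ncard_coe_finset]
  exact Nat.add_le_add_left hFc _

theorem cast_le_of_clusters {n T m D E : ℕ} (hT : 1 ≤ T) (h1 : T ≤ (m + 1) * (m + 1))
    (h2 : m * m < T) (hD : D * (m + 1) ≤ n) (hE : E ≤ n + n * (m + 1) + 3 * (T * (D * 3))) :
    (E : ℝ) ≤ 12 * (n * √(T : ℝ)) := by
  have hr1 : 1 ≤ √(T : ℝ) := Real.one_le_sqrt.mpr (by exact_mod_cast hT)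
  have hrr : √(T : ℝ) * √(T : ℝ) = T := Real.mul_self_sqrt (Nat.cast_nonneg _)
  have hm : (m : ℝ) ≤ √(T : ℝ) :=
    Real.le_sqrt_of_sq_le (by rw [sq]; exact_mod_cast h2.le)
  have hr : √(T : ℝ) ≤ m + 1 :=
    Real.sqrt_le_iff.mpr ⟨by positivity, by rw [sq]; exact_mod_cast h1⟩
  have hD' : (D : ℝ) * (m + 1) ≤ n := by exact_mod_cast hD
  have hE' : (E : ℝ) ≤ n + n * (m + 1) + 3 * (T * (D * 3)) := by exact_mod_cast hE
  have hn : (0 : ℝ) ≤ n := Nat.cast_nonneg n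
  have hDn : (0 : ℝ) ≤ D := Nat.cast_nonneg D
  -- There are at most `n / √T` clusters, because each has at least `m + 1 ≥ √T` vertices.
  have hTD : (T : ℝ) * D ≤ n * √(T : ℝ) := by
    calc (T : ℝ) * D = √(T : ℝ) * (D * √(T : ℝ)) := by
          linear_combination (-(D : ℝ)) * hrr
      _ ≤ √(T : ℝ) * (D * (m + 1)) := by gcongr
      _ ≤ √(T : ℝ) * n := by gcongr
      _ = n * √(T : ℝ) := mul_comm _ _
  have h3 : (n : ℝ) * m ≤ n * √(T : ℝ) := by gcongr
  have h4 : (n : ℝ) * 1 ≤ n * √(T : ℝ) := by gcongr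
  -- In units of `n * √T`: 1 for the stars, 2 for the edges at unclustered vertices, 9 for the
  -- bought paths.
  linarith

theorem sqrt_le_mul_sqrt_log {n T : ℕ} (hn : 2 ≤ n) {ε ε₀ : ℝ} (hε : 0 < ε) (hε₀ : ε ≤ ε₀) :
    √(T : ℝ) ≤ √(ε₀ / Real.log 2) * √(T * Real.log n / ε) := by
  have h2 : 0 < Real.log 2 := Real.log_pos (by norm_num)
  have hlog : Real.log 2 ≤ Real.log n := Real.log_le_log (by norm_num) (by exact_mod_cast hn)
  have h0 : 0 ≤ ε₀ := hε.le.trans hε₀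
  rw [← Real.sqrt_mul (by positivity)]
  refine Real.sqrt_le_sqrt ?_
  rw [div_mul_div_comm, le_div_iff₀ (by positivity)]
  calc (T : ℝ) * (Real.log 2 * ε) ≤ T * (Real.log n * ε₀) := by gcongr
    _ = ε₀ * (T * Real.log n) := by ring

end PrioritySpanner

namespace PrioritySpanner

/-! ### Programs for graphs stored as matrices

Array `4` holds the multiples of `n`, array `3` the spanner under construction. -/

/-- Cell `0` of array `a`. -/
abbrev Expr.var (a : ℕ) : Expr := .get a (.const 0)

/-- The position of the entry `(x, y)` of a matrix. -/
abbrev Expr.cell (x y : Expr) : Expr := .add (.get 4 x) y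

/-- `s` holds in array `a` a matrix whose nonzero entries are the edges of `K`. -/
structure HasMatrix {n : ℕ} (s : Memory) (a : ℕ) (K : SimpleGraph (Fin n)) : Prop where
  size_eq : s 0 0 = n
  mul_eq : ∀ x : Fin n, s 4 x = x * n
  ne_zero_iff : ∀ x y : Fin n, s a (x * n + y) ≠ 0 ↔ K.Adj x y

theorem HasMatrix.congr {n : ℕ} {s s' : Memory} {a : ℕ} {K : SimpleGraph (Fin n)}
    (h : HasMatrix s a K) (h0 : s' 0 = s 0) (h4 : s' 4 = s 4) (ha : s' a = s a) :
    HasMatrix s' a K :=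
  ⟨by rw [h0, h.size_eq], by rw [h4]; exact h.mul_eq, by rw [ha]; exact h.ne_zero_iff⟩

open scoped Classical in
/-- The matrix `h` has the entry `k` at the edges of `H`, and `0` elsewhere. -/
def Represents {n : ℕ} (k : ℕ) (h : ℕ → ℕ) (H : SimpleGraph (Fin n)) : Prop :=
  ∀ u v : Fin n, h (u * n + v) = if H.Adj u v then k else 0

theorem Represents.ne_zero_iff {n k : ℕ} {h : ℕ → ℕ} {H : SimpleGraph (Fin n)}
    (hr : Represents k h H) (hk : k ≠ 0) (u v : Fin n) : h (u * n + v) ≠ 0 ↔ H.Adj u v := by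
  rw [hr u v]
  split_ifs with hadj <;> simp [hadj, hk]

theorem mul_add_inj {n : ℕ} {u v x y : Fin n} :
    (u : ℕ) * n + v = x * n + y ↔ u = x ∧ v = y := by
  refine ⟨fun h => ?_, by rintro ⟨rfl, rfl⟩; rfl⟩
  have hn : 0 < n := u.pos
  have h1 := congrArg (· / n) h
  have h2 := congrArg (· % n) h
  simp only [mul_comm _ n, Nat.mul_add_div hn, Nat.mul_add_mod, Nat.div_eq_of_lt v.2,
    Nat.div_eq_of_lt y.2, Nat.mod_eq_of_lt v.2, Nat.mod_eq_of_lt y.2, add_zero] at h1 h2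
  exact ⟨Fin.ext h1, Fin.ext h2⟩

theorem Represents.sup_edge {n k : ℕ} {h : ℕ → ℕ} {H : SimpleGraph (Fin n)}
    (hr : Represents k h H) {x y : Fin n} (hxy : x ≠ y) :
    Represents k (Function.update (Function.update h (x * n + y) k) (y * n + x) k)
      (H ⊔ SimpleGraph.edge x y) := by
  intro u v
  have hadj : (H ⊔ SimpleGraph.edge x y).Adj u v ↔
      (u = y ∧ v = x) ∨ (u = x ∧ v = y) ∨ H.Adj u v := by
    rw [SimpleGraph.sup_adj, SimpleGraph.edge_adj]
    constructor
    · rintro (h | ⟨h | h, -⟩) <;> tauto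
    · rintro (⟨rfl, rfl⟩ | ⟨rfl, rfl⟩ | h)
      · exact .inr ⟨.inr ⟨rfl, rfl⟩, hxy.symm⟩
      · exact .inr ⟨.inl ⟨rfl, rfl⟩, hxy⟩
      · exact .inl h
  simp only [Function.update_apply, mul_add_inj, hr u v]
  by_cases h1 : u = y ∧ v = x
  · rw [if_pos h1, if_pos (hadj.mpr (.inl h1))]
  by_cases h2 : u = x ∧ v = y
  · rw [if_neg h1, if_pos h2, if_pos (hadj.mpr (.inr (.inl h2)))]
  rw [if_neg h1, if_neg h2]
  by_cases h3 : H.Adj u v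
  · rw [if_pos h3, if_pos (hadj.mpr (.inr (.inr h3)))]
  · rw [if_neg h3, if_neg (by tauto)]

namespace Cmd

/-- Add to the matrix in array `3` the edge between the contents of `a` and `b`. -/
def addEdge (a b : ℕ) : Cmd :=
  .seq (.set 3 (.cell (.var a) (.var b)) (.get 0 (.const 1)))
    (.set 3 (.cell (.var b) (.var a)) (.get 0 (.const 1)))

theorem represents_addEdge {n k : ℕ} {s : Memory} {a b : ℕ} (ha : a ≠ 3) (hb : b ≠ 3)
    {H : SimpleGraph (Fin n)} {x y : Fin n} (hx : s a 0 = x) (hy : s b 0 = y) (hxy : x ≠ y)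
    (hk : s 0 1 = k) (h4 : ∀ x : Fin n, s 4 x = x * n) (hr : Represents k (s 3) H) :
    Represents k ((addEdge a b).run s 3) (H ⊔ SimpleGraph.edge x y) := by
  have h := hr.sup_edge hxy
  simpa (disch := omega) only [addEdge, run, Expr.eval, Memory.write_same, Memory.write_of_ne, hx,
    hy, hk, h4] using h

/-! #### Distances -/

/-- Replace the tentative distance of vertex `14` by that of vertex `13` plus one, if they are
adjacent in the matrix `a` and this is an improvement. -/
def relax (a d : ℕ) : Cmd :=
  .ite (.get a (.cell (.var 13) (.var 14)))
    (.ite (.sub (.get d (.var 14)) (.add (.get d (.var 13)) (.const 1)))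
      (.set d (.var 14) (.add (.get d (.var 13)) (.const 1))) .skip) .skip

theorem writes_relax (a d : ℕ) : (relax a d).writes = [d] := rfl

theorem valid_relax (a d : ℕ) : (relax a d).Valid := ⟨⟨trivial, trivial⟩, trivial⟩

/-- Compute in array `d` the distances from the vertex in array `10` in the graph in array `a`. -/
def distances (a d : ℕ) : Cmd :=
  .seq (.iter 12 (.set d (.var 12) (.add (.var 0) (.const 2))))
    (.seq (.set d (.var 10) (.const 0)) (.iter 12 (.iter 13 (.iter 14 (relax a d)))))

section Distances

variable {n : ℕ} {K : SimpleGraph (Fin n)} {u : Fin n} {a d : ℕ}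

open scoped Classical in
theorem run_relax {s : Memory} (hs : HasMatrix s a K) {x y : Fin n} (hx : s 13 0 = x)
    (hy : s 14 0 = y) :
    (relax a d).run s d =
      if K.Adj x y ∧ s d x + 1 < s d y then Function.update (s d) y (s d x + 1) else s d := by
  have hb : (Expr.get a (.cell (.var 13) (.var 14))).eval s ≠ 0 ↔ K.Adj x y := by
    simp only [Expr.eval, hx, hy, hs.mul_eq, hs.ne_zero_iff]
  rw [relax]
  by_cases h1 : K.Adj x y
  · rw [run_ite_pos (hb.mpr h1)]
    by_cases h2 : s d x + 1 < s d y
    · rw [run_ite_pos (by simp only [Expr.eval, hx, hy]; omega), if_pos ⟨h1, h2⟩]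
      simp only [run, Expr.eval, hx, hy, Memory.write_same]
    · rw [run_ite_neg (by simp only [Expr.eval, hx, hy]; omega), if_neg (fun h => h2 h.2), run]
  · rw [run_ite_neg (not_not.mp (mt hb.mp h1)), if_neg (fun h => h1 h.1), run]

/-- Every tentative distance below the initial value `n + 2` is attained. -/
def Attained (K : SimpleGraph (Fin n)) (u : Fin n) (f : ℕ → ℕ) : Prop :=
  ∀ x : Fin n, f x < n + 2 → Near K u x (f x)

/-- The bound uses the value at `x` before the row. Values only decrease, so relaxing in place does
no harm. -/
theorem relax_row (ha : a ≤ 3) (hd : 15 ≤ d) {s : Memory} (hs : HasMatrix s a K) {x : Fin n}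
    (hx : s 13 0 = x) (hsound : Attained K u (s d)) :
    let f := (iter 14 (relax a d)).run s d
    Attained K u f ∧ (∀ z : Fin n, f z ≤ s d z) ∧
      ∀ y : Fin n, K.Adj x y → f y ≤ s d x + 1 := by
  have hv : (iter 14 (relax a d)).Valid := by
    simp [Valid, valid_relax, writes_relax]
    omega
  have h := run_iter hv s (fun j s' => Attained K u (s' d) ∧ (∀ z : Fin n, s' d z ≤ s d z) ∧
    ∀ y : Fin n, (y : ℕ) < j → K.Adj x y → s' d y ≤ s d x + 1) ?_ ?_
  · rw [hs.size_eq] at h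
    exact ⟨h.1, h.2.1, fun y => h.2.2 y y.2⟩
  · rw [Memory.write_of_ne _ _ _ (by omega)]
    exact ⟨hsound, fun z => le_rfl, fun y hy => absurd hy (Nat.not_lt_zero _)⟩
  · rintro j hj s' hjs hfr ⟨h1, h2, h3⟩
    rw [hs.size_eq] at hj
    have hfr' : ∀ b, b ≠ 14 → b ≠ d → s' b = s b := fun b hb hb' => hfr b (by
      simp [writes, writes_relax]; omega)
    rw [Memory.write_of_ne _ _ _ (by omega : d ≠ 14),
      run_relax (x := x) (y := ⟨j, hj⟩) (hs.congr (hfr' 0 (by omega) (by omega))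
        (hfr' 4 (by omega) (by omega)) (hfr' a (by omega) (by omega)))
        (by rw [hfr' 13 (by omega) (by omega), hx]) hjs]
    have hx2 := h2 x
    split_ifs with hc
    · refine ⟨fun z hz => ?_, fun z => ?_, fun y hy hadj => ?_⟩
      · rw [Function.update_apply] at hz ⊢
        split_ifs at hz ⊢ with hzj
        · have : z = ⟨j, hj⟩ := Fin.ext hzj
          subst this
          exact (h1 x (by omega)).trans (Near.of_adj hc.1)
        · exact h1 z hz
      · rw [Function.update_apply]
        split_ifs with hzj
        · have : z = ⟨j, hj⟩ := Fin.ext hzj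
          subst this
          exact hc.2.le.trans (h2 _)
        · exact h2 z
      · rw [Function.update_apply]
        split_ifs with hzj
        · omega
        · exact h3 y (by simp only at hzj; omega) hadj
    · refine ⟨h1, h2, fun y hy hadj => ?_⟩
      rcases Nat.lt_succ_iff_lt_or_eq.mp hy with hy | hy
      · exact h3 y hy hadj
      · have : y = ⟨j, hj⟩ := Fin.ext hy
        subst this
        have : ¬ (s' d x + 1 < s' d (⟨j, hj⟩ : Fin n)) := fun h => hc ⟨hadj, h⟩
        omega

theorem relax_round (ha : a ≤ 3) (hd : 15 ≤ d) {s : Memory} (hs : HasMatrix s a K)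
    (hsound : Attained K u (s d)) :
    let f := (iter 13 (iter 14 (relax a d))).run s d
    Attained K u f ∧ (∀ z : Fin n, f z ≤ s d z) ∧
      ∀ x y : Fin n, K.Adj x y → f y ≤ s d x + 1 := by
  have hv : (iter 13 (iter 14 (relax a d))).Valid := by
    simp [Valid, valid_relax, writes, writes_relax]
    omega
  have h := run_iter hv s (fun j s' => Attained K u (s' d) ∧ (∀ z : Fin n, s' d z ≤ s d z) ∧
    ∀ x : Fin n, (x : ℕ) < j → ∀ y, K.Adj x y → s' d y ≤ s d x + 1) ?_ ?_
  · rw [hs.size_eq] at h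
    exact ⟨h.1, h.2.1, fun x => h.2.2 x x.2⟩
  · rw [Memory.write_of_ne _ _ _ (by omega)]
    exact ⟨hsound, fun z => le_rfl, fun y hy => absurd hy (Nat.not_lt_zero _)⟩
  · rintro j hj s' hjs hfr ⟨h1, h2, h3⟩
    rw [hs.size_eq] at hj
    have hfr' : ∀ b, b ≠ 13 → b ≠ 14 → b ≠ d → s' b = s b := fun b hb hb' _ => hfr b (by
      simp [writes, writes_relax]; omega)
    rw [Memory.write_of_ne _ _ _ (by omega : d ≠ 13)]
    obtain ⟨g1, g2, g3⟩ := relax_row (x := ⟨j, hj⟩) ha hd (hs.congr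
      (hfr' 0 (by omega) (by omega) (by omega)) (hfr' 4 (by omega) (by omega) (by omega))
      (hfr' a (by omega) (by omega) (by omega))) hjs h1
    refine ⟨g1, fun z => (g2 z).trans (h2 z), fun x hx y hadj => ?_⟩
    rcases Nat.lt_succ_iff_lt_or_eq.mp hx with hx | hx
    · exact (g2 y).trans (h3 x hx y hadj)
    · have : x = ⟨j, hj⟩ := Fin.ext hx
      subst this
      exact (g3 y hadj).trans (Nat.add_le_add_right (h2 _) 1)

/-- This is Bellman–Ford: after `r` rounds the values are at most the length of any walk of at most
`r` edges from the source. -/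
theorem distances_spec (ha : a ≤ 3) (hd : 15 ≤ d) {s : Memory} (hs : HasMatrix s a K)
    (hu : s 10 0 = u) :
    let f := (distances a d).run s d
    Attained K u f ∧ ∀ (x : Fin n) (m : ℕ), Near K u x m → f x ≤ m := by
  have hv1 : (iter 12 (.set d (.var 12) (.add (.var 0) (.const 2)))).Valid := by
    simp [Valid, writes]
    omega
  have hv2 : (iter 12 (iter 13 (iter 14 (relax a d)))).Valid := by
    simp [Valid, valid_relax, writes, writes_relax]
    omega
  -- The value `n + 2` acts as infinity: a finite distance is below `n`, so it stays below this even
  -- after the tolerance 2 is added.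
  have hinit := run_iter hv1 s (fun j s' => ∀ x < j, s' d x = n + 2)
    (fun x hx => absurd hx (Nat.not_lt_zero _)) (by
      rintro j hj s' hjs hfr hI x hx
      have h0 : s' 0 = s 0 := hfr 0 (by simp [writes]; omega)
      simp (disch := omega) only [run, Expr.eval, Memory.write_of_ne, Memory.write_same, hjs, h0,
        hs.size_eq, Function.update_apply]
      split_ifs with h
      · rfl
      · exact hI x (by omega))
  set s1 := (iter 12 (.set d (.var 12) (.add (.var 0) (.const 2)))).run s with hs1
  have hfr1 : ∀ b, b ≠ 12 → b ≠ d → s1 b = s b := fun b hb hb' =>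
    run_of_notMem_writes _ (by
      simp [writes]; omega) _
  set s2 := s1.write d u 0 with hs2
  have hfr2 : ∀ b, b ≠ 12 → b ≠ d → s2 b = s b := fun b hb hb' => by
    rw [hs2, Memory.write_of_ne _ _ _ hb', hfr1 b hb hb']
  have hrun : (distances a d).run s = (iter 12 (iter 13 (iter 14 (relax a d)))).run s2 := by
    simp only [distances, run.eq_3]
    rw [← hs1]
    simp only [run.eq_2, Expr.eval, hfr1 10 (by omega) (by omega), hu, hs2]
  have hs2d : ∀ x : Fin n, s2 d x = if x = u then 0 else n + 2 := by
    intro x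
    rw [hs2, Memory.write_same, Function.update_apply, hinit x (by rw [hs.size_eq]; exact x.2)]
    simp only [Fin.ext_iff]
  have hm2 : HasMatrix s2 a K := hs.congr (hfr2 0 (by omega) (by omega))
    (hfr2 4 (by omega) (by omega)) (hfr2 a (by omega) (by omega))
  have h := run_iter hv2 s2 (fun r s' => Attained K u (s' d) ∧ s' d u = 0 ∧
    ∀ (x : Fin n) (m : ℕ), m ≤ r → Near K u x m → s' d x ≤ m) ?_ ?_
  · rw [hm2.size_eq, ← hrun] at h
    refine ⟨h.1, fun x m hxm => ?_⟩
    -- A shortest walk is a path and so has fewer than `n` edges; `n` rounds are enough.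
    have hlt : K.dist u x < n := by
      obtain ⟨p, hp, hpl⟩ := hxm.reachable.exists_path_of_dist
      rw [← hpl]
      simpa using hp.length_lt
    exact (h.2.2 x _ hlt.le (Near.of_dist hxm.reachable le_rfl)).trans hxm.dist_le
  · rw [Memory.write_of_ne _ _ _ (by omega)]
    refine ⟨fun x hx => ?_, by rw [hs2d, if_pos rfl], fun x m hm hx => ?_⟩
    · rw [hs2d] at hx
      split_ifs at hx with hxu
      · rw [hxu]; exact Near.refl u
      · omega
    · have : u = x := hx.reachable.dist_eq_zero_iff.mp (by have := hx.dist_le; omega)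
      rw [hs2d, if_pos this.symm]; omega
  · rintro j hj s' hjs hfr ⟨h1, h2, h4⟩
    have hfr' : ∀ b, b ≠ 12 → b ≠ 13 → b ≠ 14 → b ≠ d → s' b = s2 b := fun b _ _ _ _ => hfr b (by
      simp [writes, writes_relax]; omega)
    rw [Memory.write_of_ne _ _ _ (by omega : d ≠ 12)]
    obtain ⟨g1, g2, g3⟩ := relax_round ha hd (hm2.congr
      (hfr' 0 (by omega) (by omega) (by omega) (by omega))
      (hfr' 4 (by omega) (by omega) (by omega) (by omega))
      (hfr' a (by omega) (by omega) (by omega) (by omega))) h1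
    have g0 := Nat.le_zero.mp ((g2 u).trans_eq h2)
    refine ⟨g1, g0, fun x m hm hx => ?_⟩
    rcases m with _ | m
    · exact (g2 x).trans (h4 x 0 (Nat.zero_le _) hx)
    · obtain rfl | ⟨y, hy, hadj⟩ := hx.exists_adj
      · rw [g0]; omega
      · exact (g3 y x hadj).trans (Nat.add_le_add_right (h4 y m (by omega) hy) 1)

end Distances

end Cmd

end PrioritySpanner

namespace PrioritySpanner

/-! ### Buying a geodesic by descending the distance function -/

theorem walkGraph_concat {V : Type*} {G : SimpleGraph V} {u v w : V} (p : G.Walk u v)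
    (h : G.Adj v w) : walkGraph (p.concat h) = walkGraph p ⊔ SimpleGraph.edge v w := by
  ext x y
  have := h.ne
  simp only [walkGraph_adj, SimpleGraph.Walk.edges_concat, List.concat_eq_append, List.mem_append,
    List.mem_singleton, SimpleGraph.sup_adj, SimpleGraph.edge_adj, Sym2.eq_iff]
  constructor
  · rintro (h | ⟨rfl, rfl⟩ | ⟨rfl, rfl⟩)
    · exact .inl h
    · exact .inr ⟨.inl ⟨rfl, rfl⟩, this⟩
    · exact .inr ⟨.inr ⟨rfl, rfl⟩, this.symm⟩
  · tauto

theorem walkGraph_nil {V : Type*} {G : SimpleGraph V} (u : V) :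
    walkGraph (.nil : G.Walk u u) = ⊥ := by
  ext x y
  simp [walkGraph_adj]

namespace Cmd

/-- If the vertex in `13` is a neighbour of the current vertex, in `22`, closer to the source, buy
the edge to it and make it the current vertex. -/
def descend : Cmd :=
  .ite (.get 1 (.cell (.var 22) (.var 13)))
    (.ite (.sub (.get 20 (.var 22)) (.get 20 (.var 13)))
      (.seq (addEdge 22 13) (.set 22 (.const 0) (.var 13))) .skip) .skip

/-- Buy a shortest path from the vertex in `11` to the source of the distances in `20`. -/
def buyPath : Cmd :=
  .seq (.set 22 (.const 0) (.var 11)) (.iter 12 (.iter 13 descend))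

section BuyPath

variable {n k : ℕ} {G H : SimpleGraph (Fin n)} {u v : Fin n}

/-- The matrix `h` represents `H` together with a geodesic from `v` to `c`, where `c` lies on a
geodesic from `v` to `u`. -/
def Bought (G H : SimpleGraph (Fin n)) (k : ℕ) (u v : Fin n) (h : ℕ → ℕ) (c : Fin n) : Prop :=
  ∃ q : G.Walk v c, q.length + G.dist u c = G.dist u v ∧ Represents k h (H ⊔ walkGraph q)

theorem descend_spec (huv : G.Reachable u v) {s : Memory} (hs : HasMatrix s 1 G) (hk : s 0 1 = k)
    (hd : ∀ x : Fin n, G.Reachable u x → s 20 x = G.dist u x) {c y : Fin n}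
    (hc : s 22 0 = c) (hy : s 13 0 = y) (hb : Bought G H k u v (s 3) c) :
    ∃ c' : Fin n, descend.run s 22 0 = c' ∧ Bought G H k u v (descend.run s 3) c' ∧
      ((c' = c ∧ ¬ (G.Adj c y ∧ G.dist u y < G.dist u c)) ∨ G.dist u c' < G.dist u c) := by
  obtain ⟨q, hq, hr⟩ := hb
  have hcr : G.Reachable u c := huv.trans q.reachable
  have hadj : (Expr.get 1 (.cell (.var 22) (.var 13))).eval s ≠ 0 ↔ G.Adj c y := by
    simp only [Expr.eval, hc, hy, hs.mul_eq, hs.ne_zero_iff]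
  rw [descend]
  by_cases h1 : G.Adj c y
  · have hdc := hd c hcr
    have hdy := hd y (hcr.trans h1.reachable)
    rw [run_ite_pos (hadj.mpr h1)]
    by_cases h2 : G.dist u y < G.dist u c
    · rw [run_ite_pos (by simp only [Expr.eval, hc, hy]; omega)]
      -- Along an edge the distance drops by at most one, so a strict drop is exactly one and the
      -- walk stays geodesic.
      have hle : G.dist u c ≤ G.dist u y + 1 :=
        ((Near.of_dist (hcr.trans h1.reachable) le_rfl).trans (Near.of_adj h1.symm)).dist_le
      refine ⟨y, ?_, ⟨q.concat h1, ?_, ?_⟩, .inr h2⟩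
      · have h13 := run_of_notMem_writes (addEdge 22 13) (a := 13) (by decide) s
        simp only [run.eq_3, run.eq_2, Expr.eval, h13, hy, Memory.write_same, Function.update_self]
      · rw [SimpleGraph.Walk.length_concat]; omega
      · rw [walkGraph_concat, ← sup_assoc]
        simp only [run.eq_3, run.eq_2]
        rw [Memory.write_of_ne _ _ _ (by omega)]
        exact represents_addEdge (by omega) (by omega) hc hy h1.ne hk hs.mul_eq hr
    · rw [run_ite_neg (by simp only [Expr.eval, hc, hy]; omega)]
      exact ⟨c, hc, ⟨q, hq, hr⟩, .inl ⟨rfl, fun h => h2 h.2⟩⟩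
  · rw [run_ite_neg (not_not.mp (mt hadj.mp h1))]
    exact ⟨c, hc, ⟨q, hq, hr⟩, .inl ⟨rfl, fun h => h1 h.1⟩⟩

/-- One sweep over the vertices may move the current vertex several times, which is harmless. If it
never moved, every neighbour was tested against the same vertex, and away from the source one of
them is closer. -/
theorem descend_round (huv : G.Reachable u v) {s : Memory} (hs : HasMatrix s 1 G) (hk : s 0 1 = k)
    (hd : ∀ x : Fin n, G.Reachable u x → s 20 x = G.dist u x) {c : Fin n}
    (hc : s 22 0 = c) (hb : Bought G H k u v (s 3) c) :
    ∃ c' : Fin n, (iter 13 descend).run s 22 0 = c' ∧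
      Bought G H k u v ((iter 13 descend).run s 3) c' ∧ G.dist u c' ≤ G.dist u c - 1 := by
  have h := run_iter (by decide : (iter 13 descend).Valid) s (fun j s' => ∃ c' : Fin n,
    s' 22 0 = c' ∧ Bought G H k u v (s' 3) c' ∧
      ((c' = c ∧ ∀ y : Fin n, (y : ℕ) < j → ¬ (G.Adj c y ∧ G.dist u y < G.dist u c)) ∨
        G.dist u c' < G.dist u c)) ?_ ?_
  · obtain ⟨c', h1, h2, h3⟩ := h
    refine ⟨c', h1, h2, ?_⟩
    rcases h3 with ⟨rfl, h3⟩ | h3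
    · by_contra hlt
      obtain ⟨q, -⟩ := hb
      have hreach : G.Reachable u c' := huv.trans q.reachable
      obtain ⟨m, hm⟩ : ∃ m, G.dist u c' = m + 1 := ⟨G.dist u c' - 1, by omega⟩
      obtain rfl | ⟨x, hx, hxc⟩ := (Near.of_dist hreach hm.le).exists_adj
      · simp at hm
      · exact h3 x (by rw [hs.size_eq]; exact x.2) ⟨hxc.symm, by have := hx.dist_le; omega⟩
    · omega
  · refine ⟨c, ?_, ?_, .inl ⟨rfl, fun y hy => absurd hy (Nat.not_lt_zero _)⟩⟩
    · rw [Memory.write_of_ne _ _ _ (by omega), hc]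
    · rwa [Memory.write_of_ne _ _ _ (by omega)]
  · rintro j hj s' hjs hfr ⟨c', h1, h2, h3⟩
    rw [hs.size_eq] at hj
    rw [Memory.write_of_ne _ _ _ (by omega : 22 ≠ 13), Memory.write_of_ne _ _ _ (by omega : 3 ≠ 13)]
    obtain ⟨c'', g1, g2, g3⟩ := descend_spec (y := ⟨j, hj⟩) huv
      (hs.congr (hfr 0 (by decide)) (hfr 4 (by decide)) (hfr 1 (by decide)))
      (by rw [hfr 0 (by decide), hk]) (by rw [hfr 20 (by decide)]; exact hd) h1 hjs h2
    refine ⟨c'', g1, g2, ?_⟩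
    rcases h3 with ⟨rfl, h3⟩ | h3
    · rcases g3 with ⟨rfl, g3⟩ | g3
      · refine .inl ⟨rfl, fun y hy => ?_⟩
        rcases Nat.lt_succ_iff_lt_or_eq.mp hy with hy | hy
        · exact h3 y hy
        · have : y = ⟨j, hj⟩ := Fin.ext hy
          rwa [this]
      · exact .inr g3
    · rcases g3 with ⟨rfl, g3⟩ | g3
      · exact .inr h3
      · exact .inr (g3.trans h3)

theorem buyPath_spec (huv : G.Reachable u v) {s : Memory} (hs : HasMatrix s 1 G) (hk : s 0 1 = k)
    (hd : ∀ x : Fin n, G.Reachable u x → s 20 x = G.dist u x) (hv : s 11 0 = v)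
    (hr : Represents k (s 3) H) :
    ∃ p : G.Walk v u, p.length = G.dist v u ∧
      Represents k (buyPath.run s 3) (H ⊔ walkGraph p) := by
  set s1 := s.write 22 0 v with hs1
  have hfr1 : ∀ b, b ≠ 22 → s1 b = s b := fun b hb => Memory.write_of_ne _ _ _ hb
  have hrun : buyPath.run s = (iter 12 (iter 13 descend)).run s1 := by
    simp only [buyPath, run.eq_3, run.eq_2, Expr.eval, hv, hs1]
  have h := run_iter (by decide : (iter 12 (iter 13 descend)).Valid) s1 (fun j s' => ∃ c : Fin n,
    s' 22 0 = c ∧ Bought G H k u v (s' 3) c ∧ G.dist u c ≤ G.dist u v - j) ?_ ?_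
  · rw [hfr1 0 (by omega), hs.size_eq, ← hrun] at h
    obtain ⟨c, -, ⟨q, hq, hr'⟩, hc⟩ := h
    have hlt : G.dist u v < n := by
      obtain ⟨p, hp, hpl⟩ := huv.exists_path_of_dist
      rw [← hpl]
      simpa using hp.length_lt
    -- Each of the `n` sweeps gains at least one, and the initial distance is less than `n`, so the
    -- source has been reached.
    obtain rfl : u = c :=
      (huv.trans q.reachable).dist_eq_zero_iff.mp (by omega)
    exact ⟨q, by rw [SimpleGraph.dist_comm, ← hq]; simp, hr'⟩
  · refine ⟨v, ?_, ⟨.nil, by simp, ?_⟩, by omega⟩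
    · simp (disch := omega) only [Memory.write_of_ne, hs1, Memory.write_same, Function.update_self]
    · rw [Memory.write_of_ne _ _ _ (by omega), hfr1 3 (by omega), walkGraph_nil, sup_bot_eq]
      exact hr
  · rintro j hj s' hjs hfr ⟨c, h1, h2, h3⟩
    rw [Memory.write_of_ne _ _ _ (by omega : 22 ≠ 12), Memory.write_of_ne _ _ _ (by omega : 3 ≠ 12)]
    have hfr' : ∀ b, b ∉ (iter 12 (iter 13 descend)).writes → b ≠ 22 → s' b = s b :=
      fun b hb hb' => (hfr b hb).trans (hfr1 b hb')
    obtain ⟨c', g1, g2, g3⟩ := descend_round huv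
      (hs.congr (hfr' 0 (by decide) (by omega)) (hfr' 4 (by decide) (by omega))
        (hfr' 1 (by decide) (by omega)))
      (by rw [hfr' 0 (by decide) (by omega), hk])
      (by rw [hfr' 20 (by decide) (by omega)]; exact hd) h1 h2
    exact ⟨c', g1, g2, by omega⟩

end BuyPath

/-! #### Path buying for all pairs of terminals -/

/-- Buy a shortest path between the vertices in `10` and `11`, if both are terminals and their
distance is off by more than two. -/
def treatPair : Cmd :=
  .ite (.get 2 (.var 10)) (.ite (.get 2 (.var 11))
    (.seq (distances 1 20) (.seq (distances 3 21)
      (.ite (.sub (.get 21 (.var 11)) (.add (.get 20 (.var 11)) (.const 2))) buyPath .skip)))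
    .skip) .skip

/-- Treat all pairs of terminals. -/
def treatPairs : Cmd := .iter 10 (.iter 11 treatPair)

section TreatPairs

variable {n k : ℕ} {G : SimpleGraph (Fin n)} {T D : Finset (Fin n)} {ctr : Fin n → Fin n}

/-- The spanner may have grown from `H` to `H'` by path buying. -/
structure Grown (G : SimpleGraph (Fin n)) (T D : Finset (Fin n)) (H H' : SimpleGraph (Fin n)) :
    Prop where
  le : H ≤ H'
  le_graph : H' ≤ G
  card_le : H'.edgeSet.ncard + 3 * (good G T D H).card ≤
    H.edgeSet.ncard + 3 * (good G T D H').card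

theorem Grown.refl {H : SimpleGraph (Fin n)} (h : H ≤ G) : Grown G T D H H := ⟨le_rfl, h, le_rfl⟩

theorem Grown.trans {H H' H'' : SimpleGraph (Fin n)} (h : Grown G T D H H')
    (h' : Grown G T D H' H'') : Grown G T D H H'' :=
  ⟨h.le.trans h'.le, h'.le_graph, by have := h.card_le; have := h'.card_le; omega⟩

/-- What path buying needs to know of the memory. -/
structure Ready (G : SimpleGraph (Fin n)) (T : Finset (Fin n)) (k : ℕ) (s : Memory) : Prop where
  hasMatrix : HasMatrix s 1 G
  rate_eq : s 0 1 = k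
  terminal_iff : ∀ x : Fin n, s 2 x ≠ 0 ↔ x ∈ T

theorem Ready.congr {s s' : Memory} (h : Ready G T k s) (h0 : s' 0 = s 0) (h1 : s' 1 = s 1)
    (h2 : s' 2 = s 2) (h4 : s' 4 = s 4) : Ready G T k s' :=
  ⟨h.hasMatrix.congr h0 h4 h1, by rw [h0, h.rate_eq], by rw [h2]; exact h.terminal_iff⟩

theorem treatPair_spec (hk : k ≠ 0) (hT : ∀ x ∈ T, ∀ y ∈ T, G.Reachable x y)
    {s : Memory} (hs : Ready G T k s) {u v : Fin n} (hu : s 10 0 = u) (hv : s 11 0 = v)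
    {H : SimpleGraph (Fin n)} (hr : Represents k (s 3) H) (hHG : H ≤ G)
    (hctr : ∀ x y, G.Adj x y → ¬ H.Adj x y → ctr x ∈ D ∧ H.Adj (ctr x) x) :
    ∃ H', Represents k (treatPair.run s 3) H' ∧ Grown G T D H H' ∧
      (u ∈ T → v ∈ T → Near H' v u (G.dist v u + 2)) := by
  have hbu : (Expr.get 2 (.var 10)).eval s ≠ 0 ↔ u ∈ T := by
    simp only [Expr.eval, hu, hs.terminal_iff]
  have hbv : (Expr.get 2 (.var 11)).eval s ≠ 0 ↔ v ∈ T := by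
    simp only [Expr.eval, hv, hs.terminal_iff]
  rw [treatPair]
  by_cases huT : u ∈ T
  swap
  · rw [run_ite_neg (not_not.mp (mt hbu.mp huT))]
    exact ⟨H, hr, .refl hHG, fun h => absurd h huT⟩
  by_cases hvT : v ∈ T
  swap
  · rw [run_ite_pos (hbu.mpr huT), run_ite_neg (not_not.mp (mt hbv.mp hvT))]
    exact ⟨H, hr, .refl hHG, fun _ h => absurd h hvT⟩
  rw [run_ite_pos (hbu.mpr huT), run_ite_pos (hbv.mpr hvT)]
  simp only [run.eq_3]
  set s1 := (distances 1 20).run s with hs1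
  set s2 := (distances 3 21).run s1 with hs2
  have hfr1 : ∀ b, b ∉ (distances 1 20).writes → s1 b = s b :=
    fun b hb => run_of_notMem_writes _ hb _
  have hfr2 : ∀ b, b ∉ (distances 3 21).writes → s2 b = s1 b :=
    fun b hb => run_of_notMem_writes _ hb _
  have hfr : ∀ b, b ∉ (distances 1 20).writes → b ∉ (distances 3 21).writes → s2 b = s b :=
    fun b hb hb' => (hfr2 b hb').trans (hfr1 b hb)
  have hr2 : Represents k (s2 3) H := by rwa [hfr 3 (by decide) (by decide)]
  have hready : Ready G T k s2 := hs.congr (hfr 0 (by decide) (by decide))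
    (hfr 1 (by decide) (by decide)) (hfr 2 (by decide) (by decide)) (hfr 4 (by decide) (by decide))
  have hmH : HasMatrix s1 3 H := by
    refine ⟨by rw [hfr1 0 (by decide), hs.hasMatrix.size_eq], fun x => ?_, ?_⟩
    · rw [hfr1 4 (by decide), hs.hasMatrix.mul_eq]
    · rw [hfr1 3 (by decide)]; exact hr.ne_zero_iff hk
  obtain ⟨a1, a2⟩ := distances_spec (d := 20) (by omega) (by omega) hs.hasMatrix hu
  obtain ⟨b1, b2⟩ := distances_spec (d := 21) (by omega) (by omega) hmH
    ((congrFun (hfr1 10 (by decide)) 0).trans hu)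
  rw [← hs1, ← hfr2 20 (by decide)] at a1 a2
  rw [← hs2] at b1 b2
  have hlt : ∀ x, G.Reachable u x → G.dist u x < n := fun x hx => by
    obtain ⟨p, hp, hpl⟩ := hx.exists_path_of_dist
    rw [← hpl]
    simpa using hp.length_lt
  have hd : ∀ x : Fin n, G.Reachable u x → s2 20 x = G.dist u x := fun x hx => by
    have h1 := a2 x _ (Near.of_dist hx le_rfl)
    have h2 := hlt x hx
    exact le_antisymm h1 (a1 x (by omega)).dist_le
  have huv : G.Reachable u v := hT u huT v hvT
  have hv2 : s2 11 0 = v := (congrFun (hfr 11 (by decide) (by decide)) 0).trans hv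
  have hdv := hd v huv
  have hltv := hlt v huv
  -- When this holds the computed value is below `n + 2`, hence attained by a walk in `H`; when it
  -- fails no walk in `H` is that short.
  by_cases hfar : s2 21 v ≤ G.dist u v + 2
  · rw [run_ite_neg (by simp only [Expr.eval, hv2]; omega)]
    refine ⟨H, hr2, .refl hHG, fun _ _ => ?_⟩
    by_cases hq : s2 21 v < n + 2
    · rw [SimpleGraph.dist_comm]
      exact (b1 v hq).symm.mono hfar
    · omega
  · rw [run_ite_pos (by simp only [Expr.eval, hv2]; omega)]
    obtain ⟨p, hp, hrep⟩ := buyPath_spec huv hready.hasMatrix hready.rate_eq hd hv2 hr2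
    refine ⟨_, hrep, ⟨le_sup_left, sup_le hHG (walkGraph_le p), ?_⟩, fun _ _ => ?_⟩
    · refine card_edgeSet_add_card_good_le hHG hctr hvT huT p hp fun h => hfar (b2 v _ ?_)
      rw [SimpleGraph.dist_comm]
      exact h.symm
    · have := near_walkGraph_take p (le_sup_right : _ ≤ H ⊔ walkGraph p) p.length
      rw [SimpleGraph.Walk.getVert_length] at this
      exact this.mono (by omega)

theorem treatPairs_spec (hk : k ≠ 0) (hT : ∀ x ∈ T, ∀ y ∈ T, G.Reachable x y)
    {s : Memory} (hs : Ready G T k s)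
    {H : SimpleGraph (Fin n)} (hr : Represents k (s 3) H) (hHG : H ≤ G)
    (hctr : ∀ x y, G.Adj x y → ¬ H.Adj x y → ctr x ∈ D ∧ H.Adj (ctr x) x) :
    ∃ H', Represents k (treatPairs.run s 3) H' ∧ Grown G T D H H' ∧
      ∀ u ∈ T, ∀ v ∈ T, Near H' v u (G.dist v u + 2) := by
  -- The clustering hypothesis survives purchases: the stars remain and fewer edges are missing.
  have hctr' : ∀ {H'}, Grown G T D H H' →
      ∀ x y, G.Adj x y → ¬ H'.Adj x y → ctr x ∈ D ∧ H'.Adj (ctr x) x := fun hg x y h h' =>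
    (hctr x y h fun hH => h' (hg.le hH)).imp_right fun hH => hg.le hH
  have h := run_iter (by decide : treatPairs.Valid) s (fun i s' => ∃ H',
    Represents k (s' 3) H' ∧ Grown G T D H H' ∧
      ∀ u ∈ T, (u : ℕ) < i → ∀ v ∈ T, Near H' v u (G.dist v u + 2)) ?_ ?_
  · obtain ⟨H', h1, h2, h3⟩ := h
    exact ⟨H', h1, h2, fun u hu => h3 u hu (by rw [hs.hasMatrix.size_eq]; exact u.2)⟩
  · exact ⟨H, by rwa [Memory.write_of_ne _ _ _ (by omega)], .refl hHG,
      fun u _ hu => absurd hu (Nat.not_lt_zero _)⟩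
  rintro i hi s' his hfr ⟨H', h1, h2, h3⟩
  rw [hs.hasMatrix.size_eq] at hi
  have h := run_iter (by decide : (iter 11 treatPair).Valid) s' (fun j r => ∃ H'',
    Represents k (r 3) H'' ∧ Grown G T D H' H'' ∧
      ((⟨i, hi⟩ : Fin n) ∈ T → ∀ v ∈ T, (v : ℕ) < j → Near H'' v ⟨i, hi⟩ (G.dist v ⟨i, hi⟩ + 2)))
    ?_ ?_
  · obtain ⟨H'', g1, g2, g3⟩ := h
    rw [Memory.write_of_ne _ _ _ (by omega)]
    refine ⟨H'', g1, h2.trans g2, fun u hu hui v hv => ?_⟩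
    rcases Nat.lt_succ_iff_lt_or_eq.mp hui with hui | hui
    · exact (h3 u hu hui v hv).mono_graph g2.le
    · have : u = ⟨i, hi⟩ := Fin.ext hui
      subst this
      exact g3 hu v hv (by rw [hfr 0 (by decide), hs.hasMatrix.size_eq]; exact v.2)
  · exact ⟨H', by rwa [Memory.write_of_ne _ _ _ (by omega)], .refl h2.le_graph,
      fun _ v _ hv => absurd hv (Nat.not_lt_zero _)⟩
  rintro j hj r hjr hfr' ⟨H'', g1, g2, g3⟩
  rw [hfr 0 (by decide), hs.hasMatrix.size_eq] at hj
  have hfr2 : ∀ b, b ∉ treatPairs.writes → b ∉ (iter 11 treatPair).writes → r b = s b :=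
    fun b hb hb' => (hfr' b hb').trans (hfr b hb)
  obtain ⟨L, e1, e2, e3⟩ := treatPair_spec (u := ⟨i, hi⟩) (v := ⟨j, hj⟩) hk hT
    (hs.congr (hfr2 0 (by decide) (by decide)) (hfr2 1 (by decide) (by decide))
      (hfr2 2 (by decide) (by decide)) (hfr2 4 (by decide) (by decide)))
    ((congrFun (hfr' 10 (by decide)) 0).trans his) hjr g1 g2.le_graph (hctr' (h2.trans g2))
  rw [Memory.write_of_ne _ _ _ (by omega)]
  refine ⟨L, e1, g2.trans e2, fun hiT v hv hvj => ?_⟩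
  rcases Nat.lt_succ_iff_lt_or_eq.mp hvj with hvj | hvj
  · exact (g3 hiT v hv hvj).mono_graph e2.le
  · have : v = ⟨j, hj⟩ := Fin.ext hvj
    subst this
    exact e3 hiT hv

end TreatPairs

end Cmd

end PrioritySpanner

namespace PrioritySpanner

/-! ### Counting, clustering and the complete algorithm -/

open scoped Classical in
/-- The number of `x < j` with `P x`. -/
noncomputable def countBelow {n : ℕ} (P : Fin n → Prop) (j : ℕ) : ℕ :=
  (Finset.univ.filter fun x : Fin n => (x : ℕ) < j ∧ P x).card

theorem countBelow_zero {n : ℕ} (P : Fin n → Prop) : countBelow P 0 = 0 := by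
  simp [countBelow]

theorem countBelow_eq_card {n : ℕ} {P : Fin n → Prop} {S : Finset (Fin n)}
    (h : ∀ x, x ∈ S ↔ P x) : countBelow P n = S.card := by
  unfold countBelow
  congr 1
  ext x
  simp [h]

open scoped Classical in
theorem countBelow_succ {n : ℕ} (P : Fin n → Prop) {j : ℕ} (hj : j < n) :
    countBelow P (j + 1) = countBelow P j + if P ⟨j, hj⟩ then 1 else 0 := by
  unfold countBelow
  split_ifs with h
  · have : (Finset.univ.filter fun x : Fin n => (x : ℕ) < j + 1 ∧ P x) =
        insert ⟨j, hj⟩ (Finset.univ.filter fun x : Fin n => (x : ℕ) < j ∧ P x) := by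
      ext x
      simp only [Finset.mem_filter, Finset.mem_univ, true_and, Finset.mem_insert, Fin.ext_iff]
      constructor
      · rintro ⟨h1, h2⟩
        by_cases h3 : (x : ℕ) = j
        · exact .inl h3
        · exact .inr ⟨by omega, h2⟩
      · rintro (h1 | h1)
        · have : x = ⟨j, hj⟩ := Fin.ext h1
          subst this
          exact ⟨Nat.lt_succ_self _, h⟩
        · exact ⟨by omega, h1.2⟩
    rw [this, Finset.card_insert_of_notMem (by simp)]
  · rw [add_zero]
    congr 1
    ext x
    simp only [Finset.mem_filter, Finset.mem_univ, true_and]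
    refine and_congr_left fun hx => ⟨fun h1 => ?_, fun h1 => by omega⟩
    rcases Nat.lt_succ_iff_lt_or_eq.mp h1 with h1 | h1
    · exact h1
    · have : x = ⟨j, hj⟩ := Fin.ext h1
      exact absurd (this ▸ hx) h

open scoped Classical in
/-- The vertices at which `f` does not vanish. -/
noncomputable def clustered {n : ℕ} (f : ℕ → ℕ) : Finset (Fin n) :=
  Finset.univ.filter fun x => f x ≠ 0

open scoped Classical in
/-- The neighbours of `c` at which `f` vanishes. -/
noncomputable def freshNeighbors {n : ℕ} (G : SimpleGraph (Fin n)) (f : ℕ → ℕ) (c : Fin n) :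
    Finset (Fin n) :=
  Finset.univ.filter fun x => G.Adj c x ∧ ¬ f x ≠ 0

theorem mem_clustered {n : ℕ} {f : ℕ → ℕ} {x : Fin n} : x ∈ clustered f ↔ f x ≠ 0 := by
  simp [clustered]

theorem mem_freshNeighbors {n : ℕ} {G : SimpleGraph (Fin n)} {f : ℕ → ℕ} {c x : Fin n} :
    x ∈ freshNeighbors G f c ↔ G.Adj c x ∧ f x = 0 := by
  simp [freshNeighbors]

namespace Cmd

/-- Count the terminals in `5`. -/
def countTerminals : Cmd :=
  .iter 10 (.ite (.get 2 (.var 10)) (.set 5 (.const 0) (.add (.var 5) (.const 1))) .skip)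

/-- Write the multiples of `n` to array `4`. -/
def multiples : Cmd :=
  .iter 10 (.set 4 (.add (.var 10) (.const 1)) (.add (.get 4 (.var 10)) (.var 0)))

/-- Compute in `6` the square root of the content of `5`, rounded up; `7` holds its square. -/
def ceilSqrt : Cmd :=
  .iter 10 (.ite (.sub (.var 5) (.var 7))
    (.seq (.set 7 (.const 0) (.add (.var 7) (.add (.var 6) (.add (.var 6) (.const 1)))))
      (.set 6 (.const 0) (.add (.var 6) (.const 1)))) .skip)

/-- Count in `9` the unclustered neighbours of the vertex in `10`. -/
def countFresh : Cmd :=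
  .iter 11 (.ite (.get 1 (.cell (.var 10) (.var 11)))
    (.ite (.get 8 (.var 11)) .skip (.set 9 (.const 0) (.add (.var 9) (.const 1)))) .skip)

/-- If the vertex in `11` is an unclustered neighbour of the vertex in `10`, put it into the cluster
of the latter. -/
def join : Cmd :=
  .ite (.get 1 (.cell (.var 10) (.var 11)))
    (.ite (.get 8 (.var 11)) .skip (.seq (addEdge 10 11) (.set 8 (.var 11) (.const 1)))) .skip

/-- Make a cluster of the unclustered neighbours of the vertex in `10`, if they are at least as many
as the content of `6`. -/
def makeCluster : Cmd :=
  .seq (.set 9 (.const 0) (.const 0)) (.seq countFresh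
    (.ite (.sub (.add (.var 9) (.const 1)) (.var 6)) (.iter 11 join) .skip))

/-- Buy all edges between the vertex in `10`, if it is unclustered, and the vertex in `11`. -/
def buyFreshEdge : Cmd :=
  .ite (.get 1 (.cell (.var 10) (.var 11)))
    (.ite (.get 8 (.var 10)) .skip (addEdge 10 11)) .skip

/-- The spanner algorithm. -/
def spanner : Cmd :=
  .seq countTerminals (.ite (.var 5)
    (.seq multiples (.seq ceilSqrt (.seq (.iter 10 makeCluster)
      (.seq (.iter 10 (.iter 11 buyFreshEdge)) treatPairs)))) .skip)

section

variable {n k : ℕ} {G : SimpleGraph (Fin n)}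

theorem countTerminals_spec {T : Finset (Fin n)} {s : Memory} (hn : s 0 0 = n) (h5 : s 5 0 = 0)
    (hT : ∀ x : Fin n, s 2 x ≠ 0 ↔ x ∈ T) : countTerminals.run s 5 0 = T.card := by
  have h := run_iter (by decide : countTerminals.Valid) s
    (fun j s' => s' 5 0 = countBelow (· ∈ T) j) ?_ ?_
  · rw [hn, countBelow_eq_card fun x => Iff.rfl] at h
    exact h
  · rw [Memory.write_of_ne _ _ _ (by omega), h5, countBelow_zero]
  · intro j hj s' hjs hfr hI
    rw [hn] at hj
    have hb := hT ⟨j, hj⟩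
    rw [← hfr 2 (by decide)] at hb
    rw [countBelow_succ _ hj, Memory.write_of_ne _ _ _ (by omega)]
    split_ifs with h
    · rw [run_ite_pos (by simp only [Expr.eval, hjs]; exact hb.mpr h)]
      simp only [run, Expr.eval, Memory.write_same, Function.update_self, hI]
    · rw [run_ite_neg (by simp only [Expr.eval, hjs]; exact not_not.mp (mt hb.mp h))]
      exact hI

/-- The machine cannot multiply, so row offsets of matrices are tabulated by repeated addition. -/
theorem multiples_spec {s : Memory} (h4 : s 4 0 = 0) (hn : s 0 0 = n) (x : Fin n) :
    multiples.run s 4 x = x * n := by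
  have h := run_iter (by decide : multiples.Valid) s (fun j s' => ∀ x ≤ j, s' 4 x = x * n) ?_ ?_
  · exact h x (by rw [hn]; exact x.2.le)
  · intro x hx
    rw [Nat.le_zero.mp hx, Memory.write_of_ne _ _ _ (by omega), h4, Nat.zero_mul]
  · intro j hj s' hjs hfr hI x hx
    simp (disch := omega) only [run, Expr.eval, Memory.write_of_ne, Memory.write_same, hjs,
      hfr 0 (by decide), hn, Function.update_apply, hI j le_rfl]
    split_ifs with h
    · rw [h, Nat.succ_mul]
    · exact hI x (by omega)

theorem ceilSqrt_spec {t : ℕ} {s : Memory} (hn : s 0 0 = n) (h5 : s 5 0 = t) (h6 : s 6 0 = 0)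
    (h7 : s 7 0 = 0) (ht : 1 ≤ t) (htn : t ≤ n) :
    ∃ m, ceilSqrt.run s 6 0 = m + 1 ∧ m * m < t ∧ t ≤ (m + 1) * (m + 1) := by
  have h := run_iter (by decide : ceilSqrt.Valid) s (fun j s' => s' 7 0 = s' 6 0 * s' 6 0 ∧
    (∀ m, s' 6 0 = m + 1 → m * m < t) ∧ (t ≤ s' 6 0 * s' 6 0 ∨ j ≤ s' 6 0)) ?_ ?_
  · obtain ⟨-, h1, h2⟩ := h
    change ∀ m, ceilSqrt.run s 6 0 = m + 1 → m * m < t at h1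
    change t ≤ ceilSqrt.run s 6 0 * ceilSqrt.run s 6 0 ∨ s 0 0 ≤ ceilSqrt.run s 6 0 at h2
    have h3 : t ≤ ceilSqrt.run s 6 0 * ceilSqrt.run s 6 0 := by
      rcases h2 with h2 | h2
      · exact h2
      -- If the root was raised in every round it is at least `n ≥ t`, and so is its square.
      · exact (htn.trans (hn ▸ h2)).trans (Nat.le_mul_self _)
    obtain ⟨m, hm⟩ : ∃ m, ceilSqrt.run s 6 0 = m + 1 := by
      refine Nat.exists_eq_succ_of_ne_zero fun h0 => ?_
      rw [h0] at h3
      omega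
    exact ⟨m, hm, h1 m hm, hm ▸ h3⟩
  · simp (disch := omega) only [Memory.write_of_ne, h6, h7]
    exact ⟨trivial, fun m hm => absurd hm (by omega), .inr le_rfl⟩
  · rintro j hj s' hjs hfr ⟨h1, h2, h3⟩
    have h5' : s' 5 0 = t := by rw [hfr 5 (by decide), h5]
    simp (disch := omega) only [Memory.write_of_ne]
    by_cases hc : t ≤ s' 6 0 * s' 6 0
    · rw [run_ite_neg (by simp only [Expr.eval, h5', h1]; omega)]
      exact ⟨h1, h2, .inl hc⟩
    · rw [run_ite_pos (by simp only [Expr.eval, h5', h1]; omega)]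
      simp (disch := omega) only [run, Expr.eval, Memory.write_of_ne, Memory.write_same,
        Function.update_self, h1]
      refine ⟨by ring, fun m hm => ?_, .inr ?_⟩
      · rw [← Nat.succ_injective hm]
        omega
      · omega

theorem countFresh_spec {s : Memory} (hs : HasMatrix s 1 G) {c : Fin n} (hc : s 10 0 = c)
    (h9 : s 9 0 = 0) : countFresh.run s 9 0 = (freshNeighbors G (s 8) c).card := by
  have h := run_iter (by decide : countFresh.Valid) s
    (fun j s' => s' 9 0 = countBelow (fun x => G.Adj c x ∧ s 8 x = 0) j) ?_ ?_
  · rw [hs.size_eq, countBelow_eq_card fun x => mem_freshNeighbors] at h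
    exact h
  · rw [Memory.write_of_ne _ _ _ (by omega), h9, countBelow_zero]
  · intro j hj s' hjs hfr hI
    rw [hs.size_eq] at hj
    have hb := hs.ne_zero_iff c ⟨j, hj⟩
    rw [countBelow_succ _ hj, Memory.write_of_ne _ _ _ (by omega)]
    have e1 : (Expr.get 1 (.cell (.var 10) (.var 11))).eval s' = s 1 (c * n + j) := by
      simp only [Expr.eval, hjs, hfr 1 (by decide), hfr 10 (by decide), hfr 4 (by decide), hc,
        hs.mul_eq]
    have e8 : (Expr.get 8 (.var 11)).eval s' = s 8 j := by
      simp only [Expr.eval, hjs, hfr 8 (by decide)]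
    by_cases h1 : G.Adj c ⟨j, hj⟩
    · rw [run_ite_pos (by rw [e1]; exact hb.mpr h1)]
      by_cases h2 : s 8 j = 0
      · rw [run_ite_neg (by rw [e8, h2]), if_pos ⟨h1, h2⟩]
        simp only [run, Expr.eval, Memory.write_same, Function.update_self, hI]
      · rw [run_ite_pos (by rwa [e8]), if_neg (fun h => h2 h.2)]
        exact hI
    · rw [run_ite_neg (by rw [e1]; exact not_not.mp (mt hb.mp h1)), if_neg (fun h => h1 h.1)]
      exact hI

/-- The spanner `H` and the marks `f` may have changed to `H'` and `f'` by putting neighbours of `c`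
that satisfy `P` into a cluster with center `c`. -/
structure Joined (G : SimpleGraph (Fin n)) (c : Fin n) (P : Fin n → Prop)
    (H : SimpleGraph (Fin n)) (f : ℕ → ℕ) (H' : SimpleGraph (Fin n)) (f' : ℕ → ℕ) : Prop where
  le : H ≤ H'
  le_graph : H' ≤ G
  ne_zero_iff : ∀ x : Fin n, f' x ≠ 0 ↔ f x ≠ 0 ∨ P x ∧ G.Adj c x
  adj : ∀ x : Fin n, f x = 0 → f' x ≠ 0 → H'.Adj c x
  card_le : H'.edgeSet.ncard + (clustered f : Finset (Fin n)).card ≤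
    H.edgeSet.ncard + (clustered f' : Finset (Fin n)).card

/-- Each star edge is bought together with the marking of a new vertex, so edges never outnumber
marks. -/
theorem iter_join_spec {s : Memory} (hs : HasMatrix s 1 G) (hk : s 0 1 = k) {c : Fin n}
    (hc : s 10 0 = c) {H : SimpleGraph (Fin n)} (hr : Represents k (s 3) H) (hHG : H ≤ G) :
    ∃ H', Represents k ((iter 11 join).run s 3) H' ∧
      Joined G c (fun _ => True) H (s 8) H' ((iter 11 join).run s 8) := by
  classical
  have h := run_iter (by decide : (iter 11 join).Valid) s (fun j s' => ∃ H',
    Represents k (s' 3) H' ∧ Joined G c (fun x => (x : ℕ) < j) H (s 8) H' (s' 8)) ?_ ?_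
  · obtain ⟨H', h1, h2⟩ := h
    refine ⟨H', h1, h2.le, h2.le_graph, fun x => ?_, h2.adj, h2.card_le⟩
    have hx : (x : ℕ) < s 0 0 := by rw [hs.size_eq]; exact x.2
    rw [h2.ne_zero_iff x]
    simp only [hx, true_and]
  · refine ⟨H, by rwa [Memory.write_of_ne _ _ _ (by omega)], le_rfl, hHG, fun x => ?_,
      fun x hx hx' => ?_, ?_⟩
    · rw [Memory.write_of_ne _ _ _ (by omega)]
      simp
    · rw [Memory.write_of_ne _ _ _ (by omega)] at hx'
      exact absurd hx hx'
    · rw [Memory.write_of_ne _ _ _ (by omega)]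
  · rintro j hj s' hjs hfr ⟨H', h1, h2⟩
    rw [hs.size_eq] at hj
    have hb := hs.ne_zero_iff c ⟨j, hj⟩
    simp (disch := omega) only [Memory.write_of_ne]
    have e1 : (Expr.get 1 (.cell (.var 10) (.var 11))).eval s' = s 1 (c * n + j) := by
      simp only [Expr.eval, hjs, hfr 1 (by decide), hfr 10 (by decide), hfr 4 (by decide), hc,
        hs.mul_eq]
    have e8 : (Expr.get 8 (.var 11)).eval s' = s' 8 j := by
      simp only [Expr.eval, hjs]
    have hsame : ∀ x : Fin n, (s' 8 j ≠ 0 ∨ ¬ G.Adj c ⟨j, hj⟩) →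
        (s' 8 x ≠ 0 ↔ s 8 x ≠ 0 ∨ (x : ℕ) < j + 1 ∧ G.Adj c x) := by
      intro x hor
      rw [h2.ne_zero_iff x]
      constructor
      · rintro (h | h)
        · exact .inl h
        · exact .inr ⟨by omega, h.2⟩
      · rintro (h | ⟨h, hadj⟩)
        · exact .inl h
        rcases Nat.lt_succ_iff_lt_or_eq.mp h with h | h
        · exact .inr ⟨h, hadj⟩
        · have : x = ⟨j, hj⟩ := Fin.ext h
          subst this
          exact (h2.ne_zero_iff _).mp (hor.resolve_right fun h => h hadj)
    rw [join]
    by_cases hadj : G.Adj c ⟨j, hj⟩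
    swap
    · rw [run_ite_neg (by rw [e1]; exact not_not.mp (mt hb.mp hadj))]
      exact ⟨H', h1, h2.le, h2.le_graph, fun x => hsame x (.inr hadj), h2.adj, h2.card_le⟩
    rw [run_ite_pos (by rw [e1]; exact hb.mpr hadj)]
    by_cases hcl : s' 8 j = 0
    swap
    · rw [run_ite_pos (by rwa [e8])]
      exact ⟨H', h1, h2.le, h2.le_graph, fun x => hsame x (.inl hcl), h2.adj, h2.card_le⟩
    rw [run_ite_neg (by rw [e8, hcl])]
    simp only [run.eq_3, run.eq_2, Memory.write_same]
    rw [Memory.write_of_ne _ _ _ (by omega)]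
    simp only [Expr.eval, run_of_notMem_writes (addEdge 10 11) (a := 8) (by decide) s',
      run_of_notMem_writes (addEdge 10 11) (a := 11) (by decide) s', hjs]
    have h8 : ∀ x : Fin n, Function.update (s' 8) j 1 x ≠ 0 ↔ x = ⟨j, hj⟩ ∨ s' 8 x ≠ 0 := by
      intro x
      rw [Function.update_apply, Fin.ext_iff]
      split_ifs with h <;> simp [h]
    refine ⟨H' ⊔ SimpleGraph.edge c ⟨j, hj⟩,
      represents_addEdge (y := ⟨j, hj⟩) (by omega) (by omega)
        ((congrFun (hfr 10 (by decide)) 0).trans hc) hjs hadj.ne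
        (by rw [hfr 0 (by decide), hk]) (by rw [hfr 4 (by decide)]; exact hs.mul_eq) h1,
      h2.le.trans le_sup_left, sup_le h2.le_graph ?_, fun x => ?_, fun x hx hx' => ?_, ?_⟩
    · intro x y hxy
      rw [SimpleGraph.edge_adj] at hxy
      obtain ⟨⟨rfl, rfl⟩ | ⟨rfl, rfl⟩, -⟩ := hxy
      · exact hadj
      · exact hadj.symm
    · rw [h8, h2.ne_zero_iff x]
      constructor
      · rintro (rfl | h | h)
        · exact .inr ⟨Nat.lt_succ_self _, hadj⟩
        · exact .inl h
        · exact .inr ⟨by omega, h.2⟩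
      · rintro (h | ⟨h, h'⟩)
        · exact .inr (.inl h)
        rcases Nat.lt_succ_iff_lt_or_eq.mp h with h | h
        · exact .inr (.inr ⟨h, h'⟩)
        · exact .inl (Fin.ext h)
    · rw [h8] at hx'
      rw [SimpleGraph.sup_adj, SimpleGraph.edge_adj]
      rcases hx' with rfl | hx'
      · exact .inr ⟨.inl ⟨rfl, rfl⟩, hadj.ne⟩
      · exact .inl (h2.adj x hx hx')
    · have h9 : (clustered (Function.update (s' 8) j 1) : Finset (Fin n)) =
          insert ⟨j, hj⟩ (clustered (s' 8)) := by
        ext x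
        rw [mem_clustered, h8, Finset.mem_insert, mem_clustered]
      rw [h9, Finset.card_insert_of_notMem (by rw [mem_clustered]; exact not_not.mpr hcl)]
      have := ncard_edgeSet_sup_edge_le H' c ⟨j, hj⟩
      have := h2.card_le
      omega

/-- `H` contains the stars of clusters of size at least `d` formed by the vertices marked in `f`,
and the vertices below `j` have at most `d` unclustered neighbours. -/
structure IsClustering (G : SimpleGraph (Fin n)) (d j : ℕ) (f : ℕ → ℕ) (H : SimpleGraph (Fin n))
    (D : Finset (Fin n)) (ctr : Fin n → Fin n) : Prop where
  le_graph : H ≤ G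
  center : ∀ x : Fin n, f x ≠ 0 → ctr x ∈ D ∧ H.Adj (ctr x) x
  card_mul_le : D.card * d ≤ (clustered f : Finset (Fin n)).card
  ncard_le : H.edgeSet.ncard ≤ (clustered f : Finset (Fin n)).card
  fresh_le : ∀ c : Fin n, (c : ℕ) < j → (freshNeighbors G f c).card ≤ d

theorem makeCluster_spec {s : Memory} (hs : HasMatrix s 1 G) (hk : s 0 1 = k) {c : Fin n}
    (hc : s 10 0 = c) {d : ℕ} (hd : s 6 0 = d) {H : SimpleGraph (Fin n)} {D : Finset (Fin n)}
    {ctr : Fin n → Fin n} (hr : Represents k (s 3) H) (hcl : IsClustering G d c (s 8) H D ctr) :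
    ∃ H' D' ctr', Represents k (makeCluster.run s 3) H' ∧
      IsClustering G d (c + 1) (makeCluster.run s 8) H' D' ctr' := by
  classical
  set s1 := s.write 9 0 0 with hs1
  have hfr1 : ∀ b, b ≠ 9 → s1 b = s b := fun b hb => Memory.write_of_ne _ _ _ hb
  have hm1 : HasMatrix s1 1 G := hs.congr (hfr1 0 (by omega)) (hfr1 4 (by omega)) (hfr1 1 (by omega))
  have hcount := countFresh_spec hm1 (c := c) (by rw [hfr1 10 (by omega), hc])
    (by rw [hs1, Memory.write_same, Function.update_self])
  rw [hfr1 8 (by omega)] at hcount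
  set s2 := countFresh.run s1 with hs2
  have hfr2 : ∀ b, b ∉ countFresh.writes → b ≠ 9 → s2 b = s b := fun b hb hb' =>
    (run_of_notMem_writes _ hb _).trans (hfr1 b hb')
  have hrun : makeCluster.run s =
      (ite (.sub (.add (.var 9) (.const 1)) (.var 6)) (.iter 11 join) .skip).run s2 := rfl
  have h8 : s2 8 = s 8 := hfr2 8 (by decide) (by omega)
  have h6 : s2 6 0 = d := (congrFun (hfr2 6 (by decide) (by omega)) 0).trans hd
  have hr2 : Represents k (s2 3) H := by rwa [hfr2 3 (by decide) (by omega)]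
  rw [hrun]
  by_cases hlt : (freshNeighbors G (s 8) c).card < d
  · rw [run_ite_neg (by simp only [Expr.eval, hcount, h6]; omega)]
    refine ⟨H, D, ctr, hr2, ?_⟩
    rw [run, h8]
    refine ⟨hcl.le_graph, hcl.center, hcl.card_mul_le, hcl.ncard_le, fun x hx => ?_⟩
    rcases Nat.lt_succ_iff_lt_or_eq.mp hx with hx | hx
    · exact hcl.fresh_le x hx
    · rw [Fin.ext hx]; exact hlt.le
  · rw [run_ite_pos (by simp only [Expr.eval, hcount, h6]; omega)]
    obtain ⟨H', h1, h2⟩ := iter_join_spec (hs.congr (hfr2 0 (by decide) (by omega))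
      (hfr2 4 (by decide) (by omega)) (hfr2 1 (by decide) (by omega)))
      ((congrFun (hfr2 0 (by decide) (by omega)) 1).trans hk)
      ((congrFun (hfr2 10 (by decide) (by omega)) 0).trans hc) hr2 hcl.le_graph
    rw [h8] at h2
    set f' := (iter 11 join).run s2 8
    -- A new center brings at least `d` newly marked vertices, which is what bounds the number of
    -- centers by `n / d`.
    have hcard : (clustered (s 8) : Finset (Fin n)).card + d ≤
        (clustered f' : Finset (Fin n)).card := by
      have hdisj : Disjoint (clustered (s 8)) (freshNeighbors G (s 8) c) := by
        rw [Finset.disjoint_left]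
        intro x hx hx'
        exact mem_clustered.mp hx (mem_freshNeighbors.mp hx').2
      have hsub : clustered (s 8) ∪ freshNeighbors G (s 8) c ⊆ clustered f' := by
        intro x hx
        rw [mem_clustered, h2.ne_zero_iff]
        rcases Finset.mem_union.mp hx with hx | hx
        · exact .inl (mem_clustered.mp hx)
        · exact .inr ⟨trivial, (mem_freshNeighbors.mp hx).1⟩
      have := Finset.card_le_card hsub
      rw [Finset.card_union_of_disjoint hdisj] at this
      omega
    refine ⟨H', insert c D, fun x => if s 8 x = 0 then c else ctr x, h1, h2.le_graph,
      fun x hx => ?_, ?_, ?_, fun x hx => ?_⟩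
    · split_ifs with h0
      · exact ⟨Finset.mem_insert_self _ _, h2.adj x h0 hx⟩
      · exact ⟨Finset.mem_insert_of_mem (hcl.center x h0).1, h2.le (hcl.center x h0).2⟩
    · have := Nat.mul_le_mul_right d (Finset.card_insert_le c D)
      rw [Nat.succ_mul] at this
      have := hcl.card_mul_le
      omega
    · have := h2.card_le
      have := hcl.ncard_le
      omega
    · rcases Nat.lt_succ_iff_lt_or_eq.mp hx with hx | hx
      -- Marks are never removed, so bounds for vertices scanned earlier persist.
      · refine le_trans (Finset.card_le_card fun y hy => ?_) (hcl.fresh_le x hx)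
        rw [mem_freshNeighbors] at hy ⊢
        refine ⟨hy.1, ?_⟩
        by_contra h
        exact (h2.ne_zero_iff y).mpr (.inl h) hy.2
      · have : freshNeighbors G f' x = ∅ := by
          rw [Fin.ext hx, Finset.eq_empty_iff_forall_notMem]
          intro y hy
          rw [mem_freshNeighbors] at hy
          exact (h2.ne_zero_iff y).mpr (.inr ⟨trivial, hy.1⟩) hy.2
        rw [this]
        exact Nat.zero_le _

theorem iter_makeCluster_spec {s : Memory} (hs : HasMatrix s 1 G) (hk : s 0 1 = k) {d : ℕ}
    (hd : s 6 0 = d) (h3 : s 3 = 0) (h8 : s 8 = 0) :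
    ∃ H D ctr, Represents k ((iter 10 makeCluster).run s 3) H ∧
      IsClustering G d n ((iter 10 makeCluster).run s 8) H D ctr := by
  have h := run_iter (by decide : (iter 10 makeCluster).Valid) s (fun j s' => ∃ H D ctr,
    Represents k (s' 3) H ∧ IsClustering G d j (s' 8) H D ctr) ?_ ?_
  · rwa [hs.size_eq] at h
  · simp (disch := omega) only [Memory.write_of_ne, h3, h8]
    refine ⟨⊥, ∅, id, fun u v => by simp, bot_le, fun x hx => absurd rfl hx, by simp, by simp,
      fun c hc => absurd hc (Nat.not_lt_zero _)⟩
  · rintro j hj s' hjs hfr ⟨H, D, ctr, h1, h2⟩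
    rw [hs.size_eq] at hj
    simp (disch := omega) only [Memory.write_of_ne]
    exact makeCluster_spec (c := ⟨j, hj⟩)
      (hs.congr (hfr 0 (by decide)) (hfr 4 (by decide)) (hfr 1 (by decide)))
      (by rw [hfr 0 (by decide), hk]) hjs (by rw [hfr 6 (by decide), hd]) h1 h2

/-- Edges of `G` with an endpoint not marked in `f` may have been added to `H`. -/
structure Filled (G H : SimpleGraph (Fin n)) (f : ℕ → ℕ) (H' : SimpleGraph (Fin n)) : Prop where
  le : H ≤ H'
  adj : ∀ x y, H'.Adj x y → H.Adj x y ∨ G.Adj x y ∧ (¬ f x ≠ 0 ∨ ¬ f y ≠ 0)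

theorem buyFreshEdge_spec {s : Memory} (hs : HasMatrix s 1 G) (hk : s 0 1 = k) {x y : Fin n}
    (hx : s 10 0 = x) (hy : s 11 0 = y) {H H' : SimpleGraph (Fin n)}
    (hr : Represents k (s 3) H') (hH : Filled G H (s 8) H') :
    ∃ H'', Represents k (buyFreshEdge.run s 3) H'' ∧ Filled G H (s 8) H'' ∧ H' ≤ H'' ∧
      (G.Adj x y → s 8 x = 0 → H''.Adj x y) := by
  have hb := hs.ne_zero_iff x y
  have e1 : (Expr.get 1 (.cell (.var 10) (.var 11))).eval s = s 1 (x * n + y) := by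
    simp only [Expr.eval, hx, hy, hs.mul_eq]
  have e8 : (Expr.get 8 (.var 10)).eval s = s 8 x := by
    simp only [Expr.eval, hx]
  rw [buyFreshEdge]
  by_cases hadj : G.Adj x y
  swap
  · rw [run_ite_neg (by rw [e1]; exact not_not.mp (mt hb.mp hadj))]
    exact ⟨H', hr, hH, le_rfl, fun h => absurd h hadj⟩
  rw [run_ite_pos (by rw [e1]; exact hb.mpr hadj)]
  by_cases h8 : s 8 x = 0
  swap
  · rw [run_ite_pos (by rwa [e8])]
    exact ⟨H', hr, hH, le_rfl, fun _ h => absurd h h8⟩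
  rw [run_ite_neg (by rw [e8, h8])]
  refine ⟨_, represents_addEdge (by omega) (by omega) hx hy hadj.ne hk hs.mul_eq hr,
    ⟨hH.le.trans le_sup_left, fun u v huv => ?_⟩, le_sup_left, fun _ _ => ?_⟩
  · rw [SimpleGraph.sup_adj, SimpleGraph.edge_adj] at huv
    obtain huv | ⟨⟨rfl, rfl⟩ | ⟨rfl, rfl⟩, -⟩ := huv
    · exact hH.adj u v huv
    · exact .inr ⟨hadj, .inl (not_not.mpr h8)⟩
    · exact .inr ⟨hadj.symm, .inr (not_not.mpr h8)⟩
  · rw [SimpleGraph.sup_adj, SimpleGraph.edge_adj]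
    exact .inr ⟨.inl ⟨rfl, rfl⟩, hadj.ne⟩

theorem iter_buyFreshEdge_spec {s : Memory} (hs : HasMatrix s 1 G) (hk : s 0 1 = k)
    {H : SimpleGraph (Fin n)} (hr : Represents k (s 3) H) :
    ∃ H', Represents k ((iter 10 (iter 11 buyFreshEdge)).run s 3) H' ∧ Filled G H (s 8) H' ∧
      ∀ x y : Fin n, G.Adj x y → s 8 x = 0 → H'.Adj x y := by
  have h := run_iter (by decide : (iter 10 (iter 11 buyFreshEdge)).Valid) s (fun i s' => ∃ H',
    Represents k (s' 3) H' ∧ Filled G H (s 8) H' ∧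
      ∀ x y : Fin n, (x : ℕ) < i → G.Adj x y → s 8 x = 0 → H'.Adj x y) ?_ ?_
  · obtain ⟨H', h1, h2, h3⟩ := h
    exact ⟨H', h1, h2, fun x y => h3 x y (by rw [hs.size_eq]; exact x.2)⟩
  · exact ⟨H, by rwa [Memory.write_of_ne _ _ _ (by omega)], ⟨le_rfl, fun _ _ h => .inl h⟩,
      fun x _ hx => absurd hx (Nat.not_lt_zero _)⟩
  rintro i hi s' his hfr ⟨H', h1, h2, h3⟩
  rw [hs.size_eq] at hi
  have h := run_iter (by decide : (iter 11 buyFreshEdge).Valid) s' (fun j r => ∃ H'',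
    Represents k (r 3) H'' ∧ Filled G H (s 8) H'' ∧ H' ≤ H'' ∧
      ∀ y : Fin n, (y : ℕ) < j → G.Adj ⟨i, hi⟩ y → s 8 i = 0 → H''.Adj ⟨i, hi⟩ y) ?_ ?_
  · obtain ⟨H'', g1, g2, g3, g4⟩ := h
    rw [Memory.write_of_ne _ _ _ (by omega)]
    refine ⟨H'', g1, g2, fun x y hx hadj h8 => ?_⟩
    rcases Nat.lt_succ_iff_lt_or_eq.mp hx with hx | hx
    · exact g3 (h3 x y hx hadj h8)
    · have : x = ⟨i, hi⟩ := Fin.ext hx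
      subst this
      exact g4 y (by rw [hfr 0 (by decide), hs.size_eq]; exact y.2) hadj h8
  · exact ⟨H', by rwa [Memory.write_of_ne _ _ _ (by omega)], h2, le_rfl,
      fun y hy => absurd hy (Nat.not_lt_zero _)⟩
  rintro j hj r hjr hfr' ⟨H'', g1, g2, g3, g4⟩
  rw [hfr 0 (by decide), hs.size_eq] at hj
  have hfr2 : ∀ b, b ∉ (iter 10 (iter 11 buyFreshEdge)).writes →
      b ∉ (iter 11 buyFreshEdge).writes → r b = s b :=
    fun b hb hb' => (hfr' b hb').trans (hfr b hb)
  have h8 := hfr2 8 (by decide) (by decide)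
  obtain ⟨L, e1, e2, e3, e4⟩ := buyFreshEdge_spec (x := ⟨i, hi⟩) (y := ⟨j, hj⟩) (k := k) (H := H)
    (hs.congr (hfr2 0 (by decide) (by decide)) (hfr2 4 (by decide) (by decide))
      (hfr2 1 (by decide) (by decide))) (by rw [hfr2 0 (by decide) (by decide), hk])
    ((congrFun (hfr' 10 (by decide)) 0).trans his) hjr g1 (by rwa [h8])
  rw [h8] at e2 e4
  rw [Memory.write_of_ne _ _ _ (by omega)]
  refine ⟨L, e1, e2, g3.trans e3, fun y hy hadj h0 => ?_⟩
  rcases Nat.lt_succ_iff_lt_or_eq.mp hy with hy | hy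
  · exact e3 (g4 y hy hadj h0)
  · have : y = ⟨j, hj⟩ := Fin.ext hy
    subst this
    exact e4 hadj h0

/-- The rate `k` doubles as the edge mark in the output matrix, hence the need for `k ≠ 0` once
there are terminals. Without terminals the program stops early with the empty graph. -/
theorem spanner_spec {T : Finset (Fin n)} (hTG : ∀ x ∈ T, ∀ y ∈ T, G.Reachable x y)
    {s : Memory} (h00 : s 0 0 = n) (h01 : s 0 1 = k)
    (h1 : ∀ x y : Fin n, s 1 (x * n + y) ≠ 0 ↔ G.Adj x y) (h2 : ∀ x : Fin n, s 2 x ≠ 0 ↔ x ∈ T)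
    (hz : ∀ a, 3 ≤ a → s a = 0) (hkT : T.Nonempty → k ≠ 0) :
    ∃ H, Represents k (spanner.run s 3) H ∧ H ≤ G ∧ (H ≠ ⊥ → k ≠ 0) ∧
      (∀ u ∈ T, ∀ v ∈ T, Near H u v (G.dist u v + 2)) ∧
      (H.edgeSet.ncard : ℝ) ≤ 12 * (n * √(T.card : ℝ)) := by
  have hcount := countTerminals_spec h00 (by rw [hz 5 (by omega)]; rfl) h2
  set s1 := countTerminals.run s with hs1
  have hfr1 : ∀ b, b ∉ countTerminals.writes → s1 b = s b :=
    fun b hb => run_of_notMem_writes _ hb _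
  have hrun : spanner.run s = (ite (.var 5)
    (.seq multiples (.seq ceilSqrt (.seq (.iter 10 makeCluster)
      (.seq (.iter 10 (.iter 11 buyFreshEdge)) treatPairs)))) .skip).run s1 := rfl
  rw [hrun]
  obtain rfl | hTne := T.eq_empty_or_nonempty
  · rw [run_ite_neg (by simp only [Expr.eval, hcount, Finset.card_empty])]
    refine ⟨⊥, fun u v => ?_, bot_le, fun h => absurd rfl h, by simp, by simp⟩
    simp [run, hfr1 3 (by decide), hz 3 le_rfl]
  have hTpos : 1 ≤ T.card := hTne.card_pos
  rw [run_ite_pos (by simp only [Expr.eval, hcount]; omega)]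
  simp only [run.eq_3]
  set s2 := multiples.run s1 with hs2
  have hfr2 : ∀ b, b ∉ multiples.writes → b ∉ countTerminals.writes → s2 b = s b :=
    fun b hb hb' => (run_of_notMem_writes _ hb _).trans (hfr1 b hb')
  have hm2 : HasMatrix s2 1 G := by
    refine ⟨by rw [hfr2 0 (by decide) (by decide), h00], multiples_spec ?_ ?_, ?_⟩
    · rw [hfr1 4 (by decide), hz 4 (by omega)]; rfl
    · rw [hfr1 0 (by decide), h00]
    · rw [hfr2 1 (by decide) (by decide)]; exact h1
  obtain ⟨m, hm, hlow, hhigh⟩ := ceilSqrt_spec (t := T.card) hm2.size_eq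
    ((congrFun (run_of_notMem_writes _ (by decide) _) 0).trans hcount)
    (by rw [hfr2 6 (by decide) (by decide), hz 6 (by omega)]; rfl)
    (by rw [hfr2 7 (by decide) (by decide), hz 7 (by omega)]; rfl) hTpos (card_finset_fin_le T)
  set s3 := ceilSqrt.run s2 with hs3
  have hfr3 : ∀ b, b ∉ ceilSqrt.writes → s3 b = s2 b := fun b hb => run_of_notMem_writes _ hb _
  have hm3 : HasMatrix s3 1 G :=
    hm2.congr (hfr3 0 (by decide)) (hfr3 4 (by decide)) (hfr3 1 (by decide))
  have h01' : s3 0 1 = k := by rw [hfr3 0 (by decide), hfr2 0 (by decide) (by decide), h01]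
  obtain ⟨H, D, ctr, hr4, hcl⟩ := iter_makeCluster_spec hm3 h01' hm
    (by rw [hfr3 3 (by decide), hfr2 3 (by decide) (by decide), hz 3 le_rfl])
    (by rw [hfr3 8 (by decide), hfr2 8 (by decide) (by decide), hz 8 (by omega)])
  set s4 := (iter 10 makeCluster).run s3 with hs4
  have hfr4 : ∀ b, b ∉ (iter 10 makeCluster).writes → s4 b = s3 b :=
    fun b hb => run_of_notMem_writes _ hb _
  have hm4 : HasMatrix s4 1 G :=
    hm3.congr (hfr4 0 (by decide)) (hfr4 4 (by decide)) (hfr4 1 (by decide))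
  obtain ⟨H', hr5, hfill, hfull⟩ := iter_buyFreshEdge_spec hm4
    (by rw [hfr4 0 (by decide), h01']) hr4
  set s5 := (iter 10 (iter 11 buyFreshEdge)).run s4 with hs5
  have hfr5 : ∀ b, b ∉ (iter 10 (iter 11 buyFreshEdge)).writes → s5 b = s4 b :=
    fun b hb => run_of_notMem_writes _ hb _
  have hready : Ready G T k s5 := by
    refine ⟨hm4.congr (hfr5 0 (by decide)) (hfr5 4 (by decide)) (hfr5 1 (by decide)), ?_, ?_⟩
    · rw [hfr5 0 (by decide), hfr4 0 (by decide), h01']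
    · rw [hfr5 2 (by decide), hfr4 2 (by decide), hfr3 2 (by decide),
        hfr2 2 (by decide) (by decide)]
      exact h2
  have hk := hkT hTne
  have hHG' : H' ≤ G := fun x y h => (hfill.adj x y h).elim (fun h => hcl.le_graph h) And.left
  -- A missing edge has a clustered first endpoint, since all edges at unclustered vertices were
  -- bought.
  obtain ⟨H'', hr6, hgrown, hnear⟩ := treatPairs_spec (D := D) (ctr := ctr) hk hTG hready hr5 hHG'
    fun x y h h' => (hcl.center x fun h0 => h' (hfull x y h h0)).imp_right fun h => hfill.le h
  refine ⟨H'', hr6, hgrown.le_graph, fun _ => hk, fun u hu v hv => hnear v hv u hu,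
    cast_le_of_clusters (D := D.card) hTpos hhigh hlow ?_ ?_⟩
  · exact hcl.card_mul_le.trans (card_finset_fin_le _)
  · have e1 := hgrown.card_le
    have e2 := card_good_le G T D H''
    have e3 := ncard_edgeSet_le_of_unclustered (P := fun x : Fin n => s4 8 x ≠ 0) (d := m + 1)
      (fun c => by convert hcl.fresh_le c c.2; unfold freshNeighbors; congr!) hfill.adj
    have e4 := hcl.ncard_le.trans (card_finset_fin_le _)
    rw [Fintype.card_fin] at e3
    have e5 := Nat.mul_le_mul_left 3 e2
    omega

end

end Cmd

/-! ### Constant rates and the conclusion -/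

namespace RatedSubgraph

variable {V : Type*} {G : SimpleGraph V}

/-- A subgraph all of whose edges have the highest rate. -/
def constant {k : ℕ} (H : SimpleGraph V) (hH : H ≤ G) (hk : H ≠ ⊥ → k ≠ 0) :
    RatedSubgraph G k where
  graph := H
  graph_le := hH
  rate _ := k
  one_le_rate e he := Nat.one_le_iff_ne_zero.mpr <| hk fun h => by simp [h] at he
  rate_le _ _ := le_rfl

variable {k : ℕ} {H : SimpleGraph V} {hH : H ≤ G} {hk : H ≠ ⊥ → k ≠ 0}

theorem level_constant {i : ℕ} (hi : i ≤ k) : (constant H hH hk).level i = H := by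
  ext x y
  exact and_iff_left hi

theorem weight_constant [Finite V] :
    (constant H hH hk).weight = k * (constant H hH hk).size := by
  change ∑ᶠ e ∈ H.edgeSet, k = k * H.edgeSet.ncard
  rw [finsum_mem_eq_finite_toFinset_sum _ (Set.toFinite _), Finset.sum_const, smul_eq_mul, mul_comm,
    Set.ncard_eq_toFinset_card _ (Set.toFinite _)]

end RatedSubgraph

theorem le_inputSize (n k : ℕ) : n ≤ inputSize n k := by
  have := Nat.le_self_pow (two_ne_zero) n
  unfold inputSize
  omega

end PrioritySpanner

theorem mainTheorem6 (ε₀ : ℝ) (hε₀ : 0 < ε₀) :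
    ∃ (C : ℝ) (p : Polynomial ℕ), ∀ ε : ℝ, 0 < ε → ε ≤ ε₀ →
      ∃ P : PrioritySpanner.Program,
        ∀ (n k : ℕ) (G : SimpleGraph (Fin n)) (ℓ : Fin n → Fin (k + 1)),
          (∀ u ∈ PrioritySpanner.terminals ℓ 1, ∀ v ∈ PrioritySpanner.terminals ℓ 1,
            G.Reachable u v) →
          ∃ (s : PrioritySpanner.Memory) (t : ℕ) (H : PrioritySpanner.RatedSubgraph G k),
            PrioritySpanner.Exec P (PrioritySpanner.inputMemory G ℓ) s t ∧
            t ≤ p.eval (PrioritySpanner.inputSize n k) ∧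
            PrioritySpanner.IsOutput s H ∧
            H.IsPrioritySpanner ℓ (1 + ε) 4 ∧
            (H.size : ℝ) ≤ C * ((n : ℝ) *
              Real.sqrt (((PrioritySpanner.terminals ℓ 1).ncard : ℝ) * Real.log n / ε)) ∧
            (H.weight : ℝ) ≤ (k : ℝ) * (C * ((n : ℝ) *
              Real.sqrt (((PrioritySpanner.terminals ℓ 1).ncard : ℝ) * Real.log n / ε))) := by
  classical
  refine ⟨12 * √(ε₀ / Real.log 2), PrioritySpanner.Cmd.spanner.time, fun ε hε hεε₀ =>
    ⟨PrioritySpanner.Cmd.spanner.compile, fun n k G ℓ hconn => ?_⟩⟩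
  obtain ⟨t, hexec, ht⟩ := PrioritySpanner.Cmd.exec_compile PrioritySpanner.Cmd.spanner (by decide)
    (by decide) (PrioritySpanner.inputMemory G ℓ)
  set T : Finset (Fin n) := Finset.univ.filter fun u => 1 ≤ (ℓ u : ℕ) with hT
  have hmem : ∀ u, u ∈ T ↔ u ∈ PrioritySpanner.terminals ℓ 1 := fun u => by
    simp [hT, PrioritySpanner.terminals]
  have hncard : (PrioritySpanner.terminals ℓ 1).ncard = T.card := by
    rw [← Set.ncard_coe_finset]
    congr 1
    ext u
    exact (hmem u).symm
  obtain ⟨H, hrep, hHG, hk, hnear, hcard⟩ := PrioritySpanner.Cmd.spanner_spec (n := n) (k := k)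
    (G := G) (T := T) (s := PrioritySpanner.inputMemory G ℓ)
    (fun x hx y hy => hconn x ((hmem x).mp hx) y ((hmem y).mp hy)) (by simp [PrioritySpanner.inputMemory])
    (by simp [PrioritySpanner.inputMemory])
    (fun x y => by
      simp only [PrioritySpanner.inputMemory, one_ne_zero, if_false, if_true, PrioritySpanner.mul_add_inj]
      simp)
    (fun x => by simp [PrioritySpanner.inputMemory, hT, Nat.one_le_iff_ne_zero])
    (fun a ha => by
      funext i
      simp [PrioritySpanner.inputMemory, show a ≠ 0 by omega, show a ≠ 1 by omega,
        show a ≠ 2 by omega])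
    -- With `k = 0` all priorities vanish, so there is no terminal.
    (by
      rintro ⟨u, hu⟩ rfl
      have := (Finset.mem_filter.mp hu).2
      omega)
  have hsize : (H.edgeSet.ncard : ℝ) ≤ 12 * √(ε₀ / Real.log 2) * ((n : ℝ) *
      √(((PrioritySpanner.terminals ℓ 1).ncard : ℝ) * Real.log n / ε)) := by
    -- The logarithm vanishes at `n = 1`, so the comparison with it needs `n ≥ 2`.
    rcases Nat.lt_or_ge n 2 with hn | hn
    · have : H = ⊥ := by
        ext x y
        have : x = y := Fin.ext (by omega)
        simp [this]
      rw [this]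
      simp only [SimpleGraph.edgeSet_bot, Set.ncard_empty, Nat.cast_zero]
      positivity
    · rw [hncard]
      have := mul_le_mul_of_nonneg_left
        (PrioritySpanner.sqrt_le_mul_sqrt_log (T := T.card) hn hε hεε₀)
        (Nat.cast_nonneg (α := ℝ) n)
      linarith
  refine ⟨_, t, PrioritySpanner.RatedSubgraph.constant H hHG hk, hexec, ?_, hrep, ?_, hsize, ?_⟩
  · exact ht.trans (PrioritySpanner.eval_le_eval_of_le _ (by
      simpa [PrioritySpanner.inputMemory] using PrioritySpanner.le_inputSize n k))
  · intro i hi hik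
    rw [PrioritySpanner.RatedSubgraph.level_constant hik]
    have hsub : ∀ u ∈ PrioritySpanner.terminals ℓ i, u ∈ T := fun u hu => by
      rw [hmem]
      exact hi.trans hu
    refine ⟨hHG, fun u hu v hv => (hnear u (hsub u hu) v (hsub v hv)).reachable,
      fun u hu v hv => ?_⟩
    have h1 : (H.dist u v : ℝ) ≤ G.dist u v + 2 := by
      exact_mod_cast (hnear u (hsub u hu) v (hsub v hv)).dist_le
    -- The additive error 2 already suffices; the multiplicative term is only dropped.
    have h2 : 0 ≤ ε * (G.dist u v : ℝ) := by positivity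
    linarith
  · rw [PrioritySpanner.RatedSubgraph.weight_constant, Nat.cast_mul]
    exact mul_le_mul_of_nonneg_left hsize (Nat.cast_nonneg _)
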